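/- Let $d\ge 1$, let $\mathbb S^d\subset\mathbb R^{d+1}$ be the unit sphere with surface measure $d\omega$ and volume $\Omega_d$, let $\{Y_{k,\ell}\}_{\ell=1}^{d_k^d}$ be an orthonormal basis in $L^2(\mathbb S^d)$ of the $d_k^d$-dimensional space of spherical harmonics of degree $k$, and let $P_k^{d+1}$ be the Legendre polynomial of degree $k$ in dimension $d+1$ with $P_k^{d+1}(1)=1$. Let $\phi(t)=\sum_{k\ge0}\hat\phi_k\frac{d_k^d}{\Omega_d}P_k^{d+1}(t)$, $t\in[-1,1]$, be a positive definite spherical basis function, i.e. $\hat\phi_k=\Omega_{d-1}\int_{-1}^1P_k^{d+1}(t)\phi(t)(1-t^2)^{\frac{d-2}2}dt>0$ and $\sum_k\hat\phi_k\frac{d_k^d}{\Omega_d}<\infty$. Let $\mathcal N_\phi$ be its native space, with norm $\|f\|_\phi=\big(\sum_k\hat\phi_k^{-1}\sum_\ell|\hat f_{k,\ell}|^2\big)^{1/2}$, $\hat f_{k,\ell}=\int_{\mathbb S^d}fY_{k,\ell}\,d\omega$, let $\mathcal L_\phi f(x)=\int_{\mathbb S^d}\phi(x\cdot x')f(x')\,d\omega(x')$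 on $\mathcal N_\phi$, and for $\lambda>0$ let $(\mathcal L_\phi+\lambda I)^{-1/2}$ be defined by spectral calculus, $(\mathcal L_\phi+\lambda I)^{-1/2}f=\sum_k(\hat\phi_k+\lambda)^{-1/2}\sum_\ell\hat f_{k,\ell}Y_{k,\ell}$. Let $x_1,\dots,x_{|D|}\in\mathbb S^d$, let $w_{1,s},\dots,w_{|D|,s}$ be the weights of a quadrature rule of degree $s$ at these points (that is, $\int_{\mathbb S^d}P\,d\omega=\sum_iw_{i,s}P(x_i)$ for all spherical polynomials $P$ of degree at most $s$) with $0\le w_{i,s}\le c_1|D|^{-1}$, and let $y_i=f^*(x_i)+\varepsilon_i$, where $f^*:\mathbb S^d\to\mathbb R$ and the $\varepsilon_i$ are independent random variables with $E[\varepsilon_i]=0$ and $|\varepsilon_i|\le M$ almost surely, $M>0$. Put $y_D=(y_1,\dots,y_{|D|})^T$, $\phi_{x_i}=\phi(x_i\cdot{})$, $L_{\phi,D,W_s}f=\sum_iw_{i,s}f(x_i)\phi_{x_i}$ and $S^T_{D,W_s}\mathbf c=\sum_iw_{i,s}c_i\phi_{x_i}$. Suppose that $\gamma>d/2$ and $\hat\phi_k\sim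 k^{-2\gamma}$, i.e. there are constants $\hat c_1,\hat c_2>0$ with $\hat c_1k^{-2\gamma}\le\hat\phi_k\le\hat c_2k^{-2\gamma}$ for all $k\ge1$ and $\hat c_1\le\hat\phi_0\le\hat c_2$. Then $L_{\phi,D,W_s}f^*-S^T_{D,W_s}y_D$ and its image under $(\mathcal L_\phi+\lambda I)^{-1/2}$ lie in $\mathcal N_\phi$, and for every $0<\delta<1$ and every $\lambda>0$, with probability at least $1-\delta$, $$\left\|(\mathcal L_\phi+\lambda I)^{-1/2}\big(L_{\phi,D,W_s}f^*-S^T_{D,W_s}y_D\big)\right\|_\phi\le\tilde c'M\lambda^{-\frac d{4\gamma}}|D|^{-1/2}\log\frac3\delta,$$ where $\tilde c'$ is a constant depending only on $d$, $c_1$, $\gamma$ and $\hat c_2$. -/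

import Mathlib

open MeasureTheory ProbabilityTheory

noncomputable section

namespace SphericalWRLS

/-- The unit sphere `S^d` of the Euclidean space `ℝ^(d+1)`. -/
abbrev Sph (d : ℕ) : Type := Metric.sphere (0 : EuclideanSpace ℝ (Fin (d + 1))) 1

/-- The (unnormalized) surface measure `dω` of `S^d`. -/
def surf (d : ℕ) : Measure (Sph d) :=
  (volume : Measure (EuclideanSpace ℝ (Fin (d + 1)))).toSphere

/-- `Ω_n = 2 π^((n+1)/2) / Γ((n+1)/2)`, the volume of `S^n`. -/
def sphVol (n : ℕ) : ℝ :=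
  2 * Real.pi ^ (((n : ℝ) + 1) / 2) / Real.Gamma (((n : ℝ) + 1) / 2)

/-- The Laplace operator `∑ ∂²/∂x_i²` on polynomials in `d + 1` variables. -/
def polyLaplacian (d : ℕ) :
    MvPolynomial (Fin (d + 1)) ℝ →ₗ[ℝ] MvPolynomial (Fin (d + 1)) ℝ :=
  ∑ i : Fin (d + 1),
    (MvPolynomial.pderiv i).toLinearMap ∘ₗ (MvPolynomial.pderiv i).toLinearMap

/-- Restriction of a polynomial in `d + 1` variables to the sphere `S^d`. -/
def restrictSph (d : ℕ) : MvPolynomial (Fin (d + 1)) ℝ →ₗ[ℝ] (Sph d → ℝ) where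
  toFun p := fun x => MvPolynomial.eval (fun i => x.1 i) p
  map_add' p q := by ext x; simp
  map_smul' c p := by ext x; simp [MvPolynomial.smul_eval]

/-- The space `ℍ_k^d` of spherical harmonics of degree `k`: restrictions to `S^d` of homogeneous
harmonic polynomials of degree `k`. -/
def sphHarm (d k : ℕ) : Submodule ℝ (Sph d → ℝ) :=
  (MvPolynomial.homogeneousSubmodule (Fin (d + 1)) ℝ k ⊓ LinearMap.ker (polyLaplacian d)).map
    (restrictSph d)

/-- The space `Π_s^d` of spherical polynomials of degree at most `s`. -/
def sphPoly (d s : ℕ) : Submodule ℝ (Sph d → ℝ) :=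
  (MvPolynomial.restrictTotalDegree (Fin (d + 1)) ℝ s).map (restrictSph d)

/-- `d_k^d`, the dimension of `ℍ_k^d`. -/
def harmDim (d k : ℕ) : ℕ := Module.finrank ℝ (sphHarm d k)

/-- `Y k 1, …, Y k d_k^d` is an orthonormal basis of `ℍ_k^d` in `L²(S^d)`, for every `k`. -/
structure IsHarmONB (d : ℕ) (Y : (k : ℕ) → Fin (harmDim d k) → Sph d → ℝ) : Prop where
  orthonormal : ∀ (k : ℕ) (i j : Fin (harmDim d k)),
    ∫ x, Y k i x * Y k j x ∂(surf d) = if i = j then 1 else 0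
  span_eq : ∀ k : ℕ, Submodule.span ℝ (Set.range (Y k)) = sphHarm d k

/-- The Legendre polynomial `P_k^(d+1)` of degree `k` in dimension `d + 1`, normalized by
`P_k^(d+1)(1) = 1` and orthogonal on `[-1, 1]` with respect to the weight `(1 - t²)^((d-2)/2)`
(for `d ≥ 1`), given by its three-term recurrence
`(k + d - 1) P_{k+1} = (2k + d - 1) t P_k - k P_{k-1}`, here with `k + 1` in place of `k`. -/
def legendreP (d : ℕ) : ℕ → ℝ → ℝ
  | 0, _ => 1
  | 1, t => t
  | (k + 2), t =>
      ((2 * (k : ℝ) + d + 1) * t * legendreP d (k + 1) t - ((k : ℝ) + 1) * legendreP d k t)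
        / ((k : ℝ) + d)

/-- The Fourier-Legendre coefficient
`φ̂_k = Ω_{d-1} ∫_{-1}^1 P_k^(d+1)(t) φ(t) (1 - t²)^((d-2)/2) dt` (for `d ≥ 1`). -/
def coeff (d : ℕ) (φ : ℝ → ℝ) (k : ℕ) : ℝ :=
  sphVol (d - 1) *
    ∫ t in (-1 : ℝ)..1, legendreP d k t * φ t * (1 - t ^ 2) ^ (((d : ℝ) - 2) / 2)

/-- `φ` is a positive definite spherical basis function on `S^d`: it has positive Fourier-Legendre
coefficients with `∑ φ̂_k d_k^d / Ω_d < ∞`, and it is the sum of its Fourier-Legendre series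
(which converges absolutely and uniformly on `[-1, 1]`, so that `φ` is the continuous
representative of its `L²` class). -/
structure IsPosDefSBF (d : ℕ) (φ : ℝ → ℝ) : Prop where
  memLp : MemLp φ 2 (volume.restrict (Set.Icc (-1) 1))
  coeff_pos : ∀ k, 0 < coeff d φ k
  summable : Summable fun k => coeff d φ k * (harmDim d k / sphVol d)
  expansion : ∀ t ∈ Set.Icc (-1 : ℝ) 1,
    HasSum (fun k => coeff d φ k * (harmDim d k / sphVol d) * legendreP d k t) (φ t)

/-- The kernel section `φ_z = φ(z · ⬝)`. -/
def kernelAt (d : ℕ) (φ : ℝ → ℝ) (z : Sph d) : Sph d → ℝ :=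
  fun x => φ (inner ℝ z.1 x.1)

/-- The Fourier coefficient `f̂_{k,ℓ} = ∫ f Y_{k,ℓ} dω`. -/
def fourier {d : ℕ} (Y : (k : ℕ) → Fin (harmDim d k) → Sph d → ℝ) (f : Sph d → ℝ)
    (k : ℕ) (l : Fin (harmDim d k)) : ℝ :=
  ∫ x, f x * Y k l x ∂(surf d)

/-- `f` belongs to the native space `𝒩_φ` of the positive definite `φ`:
`f(x) = ∑_k ∑_ℓ f̂_{k,ℓ} Y_{k,ℓ}(x)` with `∑_k φ̂_k⁻¹ ∑_ℓ |f̂_{k,ℓ}|² < ∞`. -/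
def MemNative {d : ℕ} (Y : (k : ℕ) → Fin (harmDim d k) → Sph d → ℝ) (φ : ℝ → ℝ)
    (f : Sph d → ℝ) : Prop :=
  (∀ x, HasSum (fun k => ∑ l, fourier Y f k l * Y k l x) (f x)) ∧
    Summable fun k => (coeff d φ k)⁻¹ * ∑ l, fourier Y f k l ^ 2

/-- The native space norm `‖f‖_φ = (∑_k φ̂_k⁻¹ ∑_ℓ |f̂_{k,ℓ}|²)^(1/2)`, for `f` in `𝒩_φ`. -/
def nativeNorm {d : ℕ} (Y : (k : ℕ) → Fin (harmDim d k) → Sph d → ℝ) (φ : ℝ → ℝ)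
    (f : Sph d → ℝ) : ℝ :=
  Real.sqrt (∑' k, (coeff d φ k)⁻¹ * ∑ l, fourier Y f k l ^ 2)

/-- Spectral calculus of the integral operator `f ↦ ∫ φ(· · x') f(x') dω(x')`, whose eigenpairs are
`(φ̂_k, Y_{k,ℓ})`: `η(𝓛_φ) f = ∑_k η(φ̂_k) ∑_ℓ f̂_{k,ℓ} Y_{k,ℓ}`. -/
def specCalc {d : ℕ} (Y : (k : ℕ) → Fin (harmDim d k) → Sph d → ℝ) (φ : ℝ → ℝ) (η : ℝ → ℝ)
    (f : Sph d → ℝ) : Sph d → ℝ :=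
  fun x => ∑' k, η (coeff d φ k) * ∑ l, fourier Y f k l * Y k l x

/-- `(𝓛_φ + λ I)^(-1/2)`. -/
def invSqrt {d : ℕ} (Y : (k : ℕ) → Fin (harmDim d k) → Sph d → ℝ) (φ : ℝ → ℝ) (lam : ℝ) :
    (Sph d → ℝ) → Sph d → ℝ :=
  specCalc Y φ fun t => (t + lam) ^ (-(1 / 2) : ℝ)

/-- `(w_i, x_i)` is a quadrature rule of degree `s` with nonnegative weights: it integrates every
element of `Π_s^d` exactly. -/
structure IsQuadRule (d s : ℕ) {N : ℕ} (w : Fin N → ℝ) (x : Fin N → Sph d) : Prop where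
  nonneg : ∀ i, 0 ≤ w i
  exact : ∀ p ∈ sphPoly d s, ∫ z, p z ∂(surf d) = ∑ i, w i * p (x i)

/-- The sampling operator `S_D f = (f(x_1), …, f(x_N))`. -/
def sampling {d N : ℕ} (x : Fin N → Sph d) (f : Sph d → ℝ) : Fin N → ℝ :=
  fun i => f (x i)

/-- `S^T_{D,W} c = ∑ w_i c_i φ_{x_i}`. -/
def samplingT {d N : ℕ} (φ : ℝ → ℝ) (w : Fin N → ℝ) (x : Fin N → Sph d) (c : Fin N → ℝ) :
    Sph d → ℝ :=
  ∑ i, (w i * c i) • kernelAt d φ (x i)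

/-- `L_{φ,D,W} f = S^T_{D,W} S_D f = ∑ w_i f(x_i) φ_{x_i}`. -/
def empOp {d N : ℕ} (φ : ℝ → ℝ) (w : Fin N → ℝ) (x : Fin N → Sph d) (f : Sph d → ℝ) :
    Sph d → ℝ :=
  samplingT φ w x (sampling x f)

end SphericalWRLS

end

/-! ### Solid Legendre polynomials and Gaussian integration by parts -/

noncomputable section

namespace SphericalWRLS

open MvPolynomial

variable {d : ℕ}

/-! Only the noise survives in the difference: it equals `-∑ w_i ε_i φ_{x_i}`. Its Fourier
coefficients are `φ̂_k` times sampled harmonics, so the native norm after applying `(𝓛_φ +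
λ)^(-1/2)` is the `ℓ²` norm of `∑ ε_i u_i`, where `u_i = -w_i (√ρ_k Y_{k,ℓ}(x_i))` and `ρ_k = φ̂_k /
(φ̂_k + λ)` (`nativeNorm_invSqrt`). The problem becomes a concentration bound for a sum of
independent centred vectors in a Hilbert space.

By the addition theorem, `∑_ℓ Y_{k,ℓ}(x)² = d_k / Ω_d` at every point, so `‖u_i‖² = w_i² ∑ ρ_k d_k /
Ω_d`, with no dependence on `x_i`. This effective dimension is `O(λ^(-d/2γ))`, because `d_k =
O(k^(d-1))` and `φ̂_k = O(k^(-2γ))` (`exists_effectiveDimension_le`). Since `w_i ≤ c₁/N`, the sum `∑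
‖u_i‖²` is of order `λ^(-d/2γ) / N`. An exponential moment bound for a smoothed norm
(`lintegral_exp_sqrt_le`) and Markov's inequality give the tail.

The addition theorem is derived algebraically. Polar coordinates turn spherical integrals of
homogeneous polynomials into Gaussian ones, and for these integration by parts gives orthogonality
of degrees and the reproducing property of the Legendre polynomials (`exists_legPoly_mul`). The
bound on `d_k` counts Cauchy data of harmonic polynomials (`harmDim_le`). -/

theorem polyLaplacian_apply (p : MvPolynomial (Fin (d + 1)) ℝ) :
    polyLaplacian d p = ∑ i, pderiv i (pderiv i p) := by
  simp [polyLaplacian, LinearMap.sum_apply]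

/-- The space of homogeneous harmonic polynomials of degree `k` in `d + 1` variables. -/
def solidHarm (d k : ℕ) : Submodule ℝ (MvPolynomial (Fin (d + 1)) ℝ) :=
  homogeneousSubmodule (Fin (d + 1)) ℝ k ⊓ LinearMap.ker (polyLaplacian d)

theorem mem_solidHarm {k : ℕ} {p : MvPolynomial (Fin (d + 1)) ℝ} :
    p ∈ solidHarm d k ↔ p.IsHomogeneous k ∧ polyLaplacian d p = 0 := by
  simp [solidHarm, Submodule.mem_inf, mem_homogeneousSubmodule]

theorem pderiv_comm (i j : Fin (d + 1)) (p : MvPolynomial (Fin (d + 1)) ℝ) :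
    pderiv i (pderiv j p) = pderiv j (pderiv i p) := by
  induction p using MvPolynomial.induction_on with
  | C a => simp
  | add p q hp hq => simp [hp, hq]
  | mul_X p k hp =>
    have h1 : ∀ i j : Fin (d + 1), pderiv i (pderiv j (X k : MvPolynomial (Fin (d + 1)) ℝ)) = 0 :=
      fun i j => by simp [pderiv_X, Pi.single_apply, apply_ite]
    simp only [pderiv_mul, map_add, hp, h1]
    ring

theorem pderiv_mem_solidHarm {k : ℕ} {p : MvPolynomial (Fin (d + 1)) ℝ}
    (hp : p ∈ solidHarm d (k + 1)) (i : Fin (d + 1)) : pderiv i p ∈ solidHarm d k := by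
  rw [mem_solidHarm] at hp ⊢
  refine ⟨by simpa using hp.1.pderiv (i := i), ?_⟩
  have h := congrArg (pderiv i) hp.2
  rw [polyLaplacian_apply, map_sum, map_zero] at h
  rw [polyLaplacian_apply, ← h]
  refine Finset.sum_congr rfl fun j _ => ?_
  rw [pderiv_comm j i p, pderiv_comm j i]

/-- The linear form `x ↦ z · x`. -/
def linForm (z : Fin (d + 1) → ℝ) : MvPolynomial (Fin (d + 1)) ℝ := ∑ i, C (z i) * X i

/-- The quadratic form `x ↦ x · x`. -/
def normSqPoly (d : ℕ) : MvPolynomial (Fin (d + 1)) ℝ := ∑ i, X i * X i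

/-- The derivative in the direction `z`. -/
def dirDeriv (z : Fin (d + 1) → ℝ) :
    Derivation ℝ (MvPolynomial (Fin (d + 1)) ℝ) (MvPolynomial (Fin (d + 1)) ℝ) :=
  ∑ i, z i • pderiv i

theorem dirDeriv_apply (z : Fin (d + 1) → ℝ) (p : MvPolynomial (Fin (d + 1)) ℝ) :
    dirDeriv z p = ∑ i, C (z i) * pderiv i p := by
  have : dirDeriv z p = (∑ i, z i • pderiv i p) := by
    rw [dirDeriv, ← Derivation.coeFnAddMonoidHom_apply, map_sum, Finset.sum_apply]
    rfl
  rw [this]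
  exact Finset.sum_congr rfl fun i _ => by rw [smul_eq_C_mul]

theorem dirDeriv_mem_solidHarm {k : ℕ} {p : MvPolynomial (Fin (d + 1)) ℝ}
    (hp : p ∈ solidHarm d (k + 1)) (z : Fin (d + 1) → ℝ) : dirDeriv z p ∈ solidHarm d k := by
  rw [dirDeriv_apply]
  refine Submodule.sum_mem _ fun i _ => ?_
  rw [← smul_eq_C_mul]
  exact Submodule.smul_mem _ _ (pderiv_mem_solidHarm hp i)

theorem pderiv_linForm (z : Fin (d + 1) → ℝ) (i : Fin (d + 1)) :
    pderiv i (linForm z) = C (z i) := by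
  simp [linForm, pderiv_X, Pi.single_apply]

theorem pderiv_normSqPoly (i : Fin (d + 1)) :
    pderiv i (normSqPoly d) = 2 * X i := by
  simp [normSqPoly, pderiv_X, Pi.single_apply, Finset.sum_add_distrib]
  ring

theorem dirDeriv_linForm {z : Fin (d + 1) → ℝ} (hz : ∑ i, z i * z i = 1) :
    dirDeriv z (linForm z) = 1 := by
  simp only [dirDeriv_apply, pderiv_linForm]
  rw [← C_1, ← hz, map_sum]
  simp

theorem dirDeriv_normSqPoly (z : Fin (d + 1) → ℝ) :
    dirDeriv z (normSqPoly d) = 2 * linForm z := by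
  simp only [dirDeriv_apply, pderiv_normSqPoly, linForm, Finset.mul_sum]
  exact Finset.sum_congr rfl fun i _ => by ring

theorem laplacian_linForm_mul (z : Fin (d + 1) → ℝ) (p : MvPolynomial (Fin (d + 1)) ℝ) :
    polyLaplacian d (linForm z * p) = 2 * dirDeriv z p + linForm z * polyLaplacian d p := by
  simp only [polyLaplacian_apply, dirDeriv_apply, Finset.mul_sum, ← Finset.sum_add_distrib]
  refine Finset.sum_congr rfl fun i _ => ?_
  simp only [pderiv_mul, map_add, pderiv_linForm, pderiv_C]
  ring

theorem laplacian_normSqPoly_mul {k : ℕ} {p : MvPolynomial (Fin (d + 1)) ℝ}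
    (hp : p.IsHomogeneous k) :
    polyLaplacian d (normSqPoly d * p) =
      C (2 * ((d : ℝ) + 1) + 4 * k) * p + normSqPoly d * polyLaplacian d p := by
  have hE : ∑ i, X i * pderiv i p = C (k : ℝ) * p := by
    rw [hp.sum_X_mul_pderiv]; simp
  have : polyLaplacian d (normSqPoly d * p) =
      ∑ i : Fin (d + 1), (2 * p + 4 * (X i * pderiv i p) +
        normSqPoly d * pderiv i (pderiv i p)) := by
    rw [polyLaplacian_apply]
    refine Finset.sum_congr rfl fun i _ => ?_
    simp only [pderiv_mul, map_add, pderiv_normSqPoly, pderiv_X_self]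
    have h2 : pderiv i (2 : MvPolynomial (Fin (d + 1)) ℝ) = 0 := by
      exact_mod_cast Derivation.map_natCast (pderiv i) 2
    rw [h2]
    ring
  rw [this]
  simp only [Finset.sum_add_distrib, ← Finset.mul_sum, hE, ← polyLaplacian_apply]
  have h2 : (2 : MvPolynomial (Fin (d + 1)) ℝ) = C 2 := by simp only [map_ofNat]
  have h4 : (4 : MvPolynomial (Fin (d + 1)) ℝ) = C 4 := by simp only [map_ofNat]
  simp [h2, h4]
  ring

/-- The solid Legendre polynomials `x ↦ |x|^k P_k(z · x / |x|)`, for a unit vector `z`. -/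
def legPoly (z : Fin (d + 1) → ℝ) : ℕ → MvPolynomial (Fin (d + 1)) ℝ
  | 0 => 1
  | 1 => linForm z
  | (k + 2) => C ((2 * (k : ℝ) + d + 1) / (k + d)) * (linForm z * legPoly z (k + 1)) -
      C (((k : ℝ) + 1) / (k + d)) * (normSqPoly d * legPoly z k)

theorem linForm_isHomogeneous (z : Fin (d + 1) → ℝ) : (linForm z).IsHomogeneous 1 :=
  IsHomogeneous.sum _ _ _ fun i _ => by
    simpa using (isHomogeneous_C _ (z i)).mul (isHomogeneous_X ℝ i)

theorem normSqPoly_isHomogeneous : (normSqPoly d).IsHomogeneous 2 :=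
  IsHomogeneous.sum _ _ _ fun i _ => (isHomogeneous_X ℝ i).mul (isHomogeneous_X ℝ i)

theorem legPoly_isHomogeneous (z : Fin (d + 1) → ℝ) (k : ℕ) :
    (legPoly z k).IsHomogeneous k := by
  induction k using Nat.twoStepInduction with
  | zero => exact isHomogeneous_one _ _
  | one => exact linForm_isHomogeneous z
  | more k h0 h1 =>
    rw [legPoly]
    refine IsHomogeneous.sub ?_ ?_
    · have := (isHomogeneous_C (Fin (d + 1)) ((2 * (k : ℝ) + d + 1) / (k + d))).mul
        ((linForm_isHomogeneous z).mul h1)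
      rwa [show 0 + (1 + (k + 1)) = k + 2 by omega] at this
    · have := (isHomogeneous_C (Fin (d + 1)) (((k : ℝ) + 1) / (k + d))).mul
        (normSqPoly_isHomogeneous.mul h0)
      rwa [show 0 + (2 + k) = k + 2 by omega] at this

theorem dirDeriv_mul (z : Fin (d + 1) → ℝ) (p q : MvPolynomial (Fin (d + 1)) ℝ) :
    dirDeriv z (p * q) = dirDeriv z p * q + p * dirDeriv z q := by
  rw [Derivation.leibniz]; simp only [smul_eq_mul]; ring

theorem legPoly_add_two (hd : 1 ≤ d) (z : Fin (d + 1) → ℝ) (k : ℕ) :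
    ((k : MvPolynomial (Fin (d + 1)) ℝ) + d) * legPoly z (k + 2) =
      ((2 : MvPolynomial (Fin (d + 1)) ℝ) * k + d + 1) * (linForm z * legPoly z (k + 1)) -
        (k + 1) * (normSqPoly d * legPoly z k) := by
  have hd' : (1 : ℝ) ≤ d := by exact_mod_cast hd
  have hk0 : ((k : ℝ) + d) ≠ 0 := by positivity
  have e : ((k : MvPolynomial (Fin (d + 1)) ℝ) + d) = C (σ := Fin (d + 1)) ((k : ℝ) + d) := by
    simp
  have e1 : C (σ := Fin (d + 1)) ((k : ℝ) + d) * C (σ := Fin (d + 1)) ((2 * (k : ℝ) + d + 1) / (k + d)) =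
      ((2 : MvPolynomial (Fin (d + 1)) ℝ) * k + d + 1) := by
    rw [← C_mul, mul_div_cancel₀ _ hk0]
    simp only [map_add, map_mul, map_natCast, map_one, map_ofNat]
  have e2 : C ((k : ℝ) + d) * C (((k : ℝ) + 1) / (k + d)) =
      (k + 1 : MvPolynomial (Fin (d + 1)) ℝ) := by
    rw [← C_mul, mul_div_cancel₀ _ hk0]
    simp only [map_add, map_natCast, map_one]
  rw [legPoly, e]
  linear_combination (linForm z * legPoly z (k + 1)) * e1 - (normSqPoly d * legPoly z k) * e2

theorem natCast_add_ne_zero (hd : 1 ≤ d) (k : ℕ) :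
    (k : MvPolynomial (Fin (d + 1)) ℝ) + d ≠ 0 := by
  have : ((k + d : ℕ) : MvPolynomial (Fin (d + 1)) ℝ) ≠ 0 := Nat.cast_ne_zero.2 (by omega)
  exact_mod_cast this

theorem dirDeriv_natCast_mul (z : Fin (d + 1) → ℝ) (a : ℕ) (p : MvPolynomial (Fin (d + 1)) ℝ) :
    dirDeriv z (a * p) = a * dirDeriv z p := by
  rw [dirDeriv_mul, Derivation.map_natCast]; simp

/-- Differentiating the recurrence along the unit vector `z` and inserting the two previous cases
leaves `k + 2` times the original recurrence. This one identity drives both harmonicity and the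
reproducing property below. -/
theorem dirDeriv_legPoly (hd : 1 ≤ d) {z : Fin (d + 1) → ℝ} (hz : ∑ i, z i * z i = 1) (k : ℕ) :
    dirDeriv z (legPoly z (k + 1)) = (k + 1) * legPoly z k := by
  have key : ∀ n : ℕ, ((n : MvPolynomial (Fin (d + 1)) ℝ) + d) * dirDeriv z (legPoly z (n + 2)) =
      (2 * n + d + 1) * (legPoly z (n + 1) + linForm z * dirDeriv z (legPoly z (n + 1))) -
        (n + 1) * (2 * linForm z * legPoly z n + normSqPoly d * dirDeriv z (legPoly z n)) := by
    intro n
    have h := congrArg (dirDeriv z) (legPoly_add_two hd z n)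
    have c1 : ((n : MvPolynomial (Fin (d + 1)) ℝ) + d) = ((n + d : ℕ) : _) := by push_cast; ring
    have c2 : (2 * (n : MvPolynomial (Fin (d + 1)) ℝ) + d + 1) = ((2 * n + d + 1 : ℕ) : _) := by
      push_cast; ring
    have c3 : ((n : MvPolynomial (Fin (d + 1)) ℝ) + 1) = ((n + 1 : ℕ) : _) := by push_cast; ring
    rw [map_sub, c1, c2, c3, dirDeriv_natCast_mul, dirDeriv_natCast_mul, dirDeriv_natCast_mul,
      dirDeriv_mul, dirDeriv_mul, dirDeriv_linForm hz, dirDeriv_normSqPoly, one_mul] at h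
    rw [c1, c2, c3, h]
  induction k using Nat.twoStepInduction with
  | zero => simp [legPoly, dirDeriv_linForm hz]
  | one =>
    apply mul_left_cancel₀ (natCast_add_ne_zero hd 0)
    have h := key 0
    have h1 : dirDeriv z (1 : MvPolynomial (Fin (d + 1)) ℝ) = 0 := Derivation.map_one_eq_zero _
    have e0 : legPoly z 0 = 1 := rfl
    have e1 : legPoly z (0 + 1) = linForm z := rfl
    rw [e0, e1, h1, dirDeriv_linForm hz] at h
    rw [show (1 + 1 : ℕ) = 0 + 2 from rfl, h, show legPoly z 1 = linForm z from rfl]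
    push_cast
    ring
  | more k ih0 ih1 =>
    apply mul_left_cancel₀ (natCast_add_ne_zero hd (k + 1))
    have h := key (k + 1)
    rw [ih0] at h
    rw [show k + 1 + 2 = k + 2 + 1 by omega, show k + 1 + 1 = k + 2 by omega] at h
    rw [show k + 1 + 1 = k + 2 by omega] at ih1
    rw [h, ih1]
    push_cast
    linear_combination (-(k : MvPolynomial (Fin (d + 1)) ℝ) - 2) * legPoly_add_two hd z k

/-- Applying the Laplacian to the recurrence leaves two multiples of `legPoly z k`, by the
derivative formula and the Laplacian of `|x|² p`. They cancel because `(2k + d + 1) · 2(k + 1) = (k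
+ 1)(2(d + 1) + 4k)`. -/
theorem legPoly_mem_solidHarm (hd : 1 ≤ d) {z : Fin (d + 1) → ℝ} (hz : ∑ i, z i * z i = 1)
    (k : ℕ) : legPoly z k ∈ solidHarm d k := by
  refine mem_solidHarm.2 ⟨legPoly_isHomogeneous z k, ?_⟩
  induction k using Nat.twoStepInduction with
  | zero => simp [legPoly, polyLaplacian_apply]
  | one => simp [legPoly, polyLaplacian_apply, pderiv_linForm]
  | more k ih0 ih1 =>
    have h := laplacian_linForm_mul z (legPoly z (k + 1))
    have h' := laplacian_normSqPoly_mul (legPoly_isHomogeneous z k)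
    rw [ih1, dirDeriv_legPoly hd hz] at h
    rw [ih0] at h'
    rw [legPoly, ← smul_eq_C_mul, ← smul_eq_C_mul, map_sub, map_smul, map_smul, h, h',
      smul_eq_C_mul, smul_eq_C_mul]
    have hd' : (1 : ℝ) ≤ d := by exact_mod_cast hd
    have hk0 : ((k : ℝ) + d) ≠ 0 := by positivity
    have e : C ((2 * (k : ℝ) + d + 1) / (k + d)) * C (2 * ((k : ℝ) + 1)) =
      C (((k : ℝ) + 1) / (k + d)) * (C (2 * ((d : ℝ) + 1) + 4 * k) :
        MvPolynomial (Fin (d + 1)) ℝ) := by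
      rw [← C_mul, ← C_mul]
      congr 1
      field_simp
      ring
    have e2 : (C (2 * ((k : ℝ) + 1)) : MvPolynomial (Fin (d + 1)) ℝ) = 2 * (k + 1) := by
      simp only [map_add, map_mul, map_natCast, map_one, map_ofNat]
    rw [e2] at e
    linear_combination legPoly z k * e

theorem eval_dirDeriv {k : ℕ} {p : MvPolynomial (Fin (d + 1)) ℝ} (hp : p.IsHomogeneous k)
    (z : Fin (d + 1) → ℝ) : eval z (dirDeriv z p) = k * eval z p := by
  have h := congrArg (eval z) hp.sum_X_mul_pderiv
  rw [dirDeriv_apply]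
  simpa [map_sum] using h

/-- A Gaussian functional on polynomials: it satisfies the integration by parts rule of the
standard Gaussian measure. -/
def IsGaussianFunctional (E : MvPolynomial (Fin (d + 1)) ℝ →ₗ[ℝ] ℝ) : Prop :=
  ∀ i p, E (X i * p) = E (pderiv i p)

namespace IsGaussianFunctional

variable {E : MvPolynomial (Fin (d + 1)) ℝ →ₗ[ℝ] ℝ}

theorem map_C_mul (E : MvPolynomial (Fin (d + 1)) ℝ →ₗ[ℝ] ℝ) (a : ℝ)
    (p : MvPolynomial (Fin (d + 1)) ℝ) : E (C a * p) = a * E p := by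
  rw [← smul_eq_C_mul, map_smul, smul_eq_mul]

theorem linForm_mul (hE : IsGaussianFunctional E) (z : Fin (d + 1) → ℝ)
    (p : MvPolynomial (Fin (d + 1)) ℝ) : E (linForm z * p) = E (dirDeriv z p) := by
  rw [linForm, dirDeriv_apply, Finset.sum_mul, map_sum, map_sum]
  refine Finset.sum_congr rfl fun i _ => ?_
  rw [mul_assoc, map_C_mul, map_C_mul, hE]

theorem normSqPoly_mul (hE : IsGaussianFunctional E) {k : ℕ}
    {p : MvPolynomial (Fin (d + 1)) ℝ} (hp : p.IsHomogeneous k) :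
    E (normSqPoly d * p) = (d + 1 + k) * E p := by
  rw [normSqPoly, Finset.sum_mul, map_sum]
  have : ∀ i : Fin (d + 1), E (X i * X i * p) = E p + E (X i * pderiv i p) := fun i => by
    rw [mul_assoc, hE, pderiv_mul, pderiv_X_self, one_mul, map_add]
  simp only [this]
  rw [Finset.sum_add_distrib, ← map_sum E (fun i => X i * pderiv i p), hp.sum_X_mul_pderiv,
    map_nsmul]
  simp only [Finset.sum_const, Finset.card_univ, Fintype.card_fin, nsmul_eq_mul]
  push_cast
  ring

/-- Euler's identity writes `(k + 1) h` as `∑ X_i ∂_i h`, and integration by parts turns this into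
`E (Δ h)`. -/
theorem solidHarm_eq_zero (hE : IsGaussianFunctional E) {k : ℕ}
    {h : MvPolynomial (Fin (d + 1)) ℝ} (hh : h ∈ solidHarm d (k + 1)) : E h = 0 := by
  rw [mem_solidHarm] at hh
  have h1 := congrArg E hh.1.sum_X_mul_pderiv
  have h2 := congrArg E hh.2
  rw [polyLaplacian_apply, map_zero, map_sum] at h2
  rw [map_sum, Finset.sum_congr rfl fun i _ => hE i _, h2, map_nsmul] at h1
  have hk : ((k : ℝ) + 1) ≠ 0 := by positivity
  simpa [hk] using h1.symm

/-- Integrating one variable of the monomial by parts puts the derivative either on `h`, lowering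
both degrees by one, or on the rest of the monomial, which loses two degrees in all. The monomial
has the smaller degree and is exhausted first, so the previous lemma ends the recursion. -/
theorem monomial_mul_solidHarm (hE : IsGaussianFunctional E) (j : ℕ) :
    ∀ (m : ℕ), j < m → ∀ s : Fin (d + 1) →₀ ℕ, s.degree = j →
      ∀ h ∈ solidHarm d m, E (monomial s 1 * h) = 0 := by
  induction j using Nat.strong_induction_on with
  | _ j ih =>
    intro m hm s hs h hh
    obtain ⟨m, rfl⟩ : ∃ m', m = m' + 1 := ⟨m - 1, by omega⟩
    by_cases hs0 : s = 0
    · subst hs0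
      simpa using hE.solidHarm_eq_zero hh
    obtain ⟨i, hi⟩ : ∃ i, s i ≠ 0 := by
      by_contra! hcon
      exact hs0 (Finsupp.ext hcon)
    set t : Fin (d + 1) →₀ ℕ := s - Finsupp.single i 1 with ht
    have hst : s = Finsupp.single i 1 + t := by
      rw [ht, add_tsub_cancel_of_le]
      rw [Finsupp.single_le_iff]; omega
    have hdeg : t.degree + 1 = j := by
      rw [← hs, hst, map_add]; simp [add_comm]
    have hX : (monomial s 1 : MvPolynomial (Fin (d + 1)) ℝ) = X i * monomial t 1 := by
      rw [X, monomial_mul, ← hst, one_mul]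
    rw [hX, mul_assoc, hE, pderiv_mul, map_add,
      ih t.degree (by omega) m (by omega) t rfl _ (pderiv_mem_solidHarm hh i), add_zero,
      pderiv_monomial, one_mul]
    by_cases hti : t i = 0
    · simp [hti]
    · have : (t - Finsupp.single i 1).degree + 1 = t.degree := by
        have h2 : Finsupp.single i 1 + (t - Finsupp.single i 1) = t := by
          rw [add_tsub_cancel_of_le]
          rw [Finsupp.single_le_iff]; omega
        conv_rhs => rw [← h2, map_add]
        simp [add_comm]
      have hsm : (monomial (t - Finsupp.single i 1) ((t i : ℝ)) :
          MvPolynomial (Fin (d + 1)) ℝ) = C (t i : ℝ) * monomial (t - Finsupp.single i 1) 1 := by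
        rw [C_mul_monomial, mul_one]
      rw [hsm, mul_assoc, map_C_mul,
        ih _ (by omega) (m + 1) (by omega) _ rfl _ hh, mul_zero]

theorem mul_solidHarm_of_lt (hE : IsGaussianFunctional E) {j m : ℕ} (hjm : j < m)
    {q h : MvPolynomial (Fin (d + 1)) ℝ} (hq : q.IsHomogeneous j) (hh : h ∈ solidHarm d m) :
    E (q * h) = 0 := by
  rw [q.as_sum, Finset.sum_mul, map_sum]
  refine Finset.sum_eq_zero fun s hs => ?_
  have hsm : (monomial s (MvPolynomial.coeff s q) : MvPolynomial (Fin (d + 1)) ℝ) =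
      C (MvPolynomial.coeff s q) * monomial s 1 := by
    rw [C_mul_monomial, mul_one]
  rw [hsm, mul_assoc, map_C_mul, hE.monomial_mul_solidHarm j m hjm s _ h hh, mul_zero]
  have := hq (mem_support_iff.1 hs)
  rw [Finsupp.degree_eq_weight_one]
  exact this

/-- The point is that `β` depends on neither `z` nor `h`. In the recurrence the `|x|²` term pairs
`h` with a lower degree and vanishes. In the other term `z · x` becomes a derivative along `z`: on
`legPoly z (k + 1)` it again yields lower degree, and on `h` it yields the case `k + 1`, with
Euler's factor `k + 2`. -/
theorem exists_legPoly_mul (hE : IsGaussianFunctional E) (hd : 1 ≤ d) (k : ℕ) :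
    ∃ β : ℝ, ∀ z : Fin (d + 1) → ℝ, ∑ i, z i * z i = 1 → ∀ h ∈ solidHarm d k,
      E (legPoly z k * h) = β * eval z h := by
  induction k using Nat.twoStepInduction with
  | zero =>
    refine ⟨E 1, fun z _ h hh => ?_⟩
    have h0 := (mem_solidHarm.1 hh).1
    rw [legPoly, one_mul, h0.totalDegree_le.antisymm bot_le |> totalDegree_eq_zero_iff_eq_C.1]
    rw [← mul_one (C _), map_C_mul, mul_one, eval_C, mul_comm]
  | one =>
    refine ⟨E 1, fun z _ h hh => ?_⟩
    have h0 := (mem_solidHarm.1 (dirDeriv_mem_solidHarm hh z)).1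
    have h1 := eval_dirDeriv (mem_solidHarm.1 hh).1 z
    rw [h0.totalDegree_le.antisymm bot_le |> totalDegree_eq_zero_iff_eq_C.1, eval_C] at h1
    rw [legPoly, hE.linForm_mul,
      h0.totalDegree_le.antisymm bot_le |> totalDegree_eq_zero_iff_eq_C.1]
    rw [← mul_one (C _), map_C_mul, h1]
    simp [mul_comm]
  | more k _ ih1 =>
    obtain ⟨β, hβ⟩ := ih1
    refine ⟨(2 * (k : ℝ) + d + 1) / (k + d) * β * (k + 2), fun z hz h hh => ?_⟩
    have h1 : E (legPoly z (k + 1) * dirDeriv z h) = β * ((k + 2) * eval z h) := by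
      rw [hβ z hz _ (dirDeriv_mem_solidHarm hh z), eval_dirDeriv (mem_solidHarm.1 hh).1]
      push_cast
      ring
    have h2 : E (dirDeriv z (legPoly z (k + 1)) * h) = 0 := by
      rw [dirDeriv_legPoly hd hz]
      have e : ((k : MvPolynomial (Fin (d + 1)) ℝ) + 1) = C ((k : ℝ) + 1) := by simp
      rw [e, mul_assoc, map_C_mul,
        hE.mul_solidHarm_of_lt (by omega) (legPoly_isHomogeneous z k) hh, mul_zero]
    have h3 : E (normSqPoly d * (legPoly z k * h)) = 0 := by
      rw [hE.normSqPoly_mul ((legPoly_isHomogeneous z k).mul (mem_solidHarm.1 hh).1),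
        hE.mul_solidHarm_of_lt (by omega) (legPoly_isHomogeneous z k) hh, mul_zero]
    rw [legPoly, sub_mul, map_sub, mul_assoc, mul_assoc, mul_assoc, mul_assoc, map_C_mul,
      map_C_mul, h3, hE.linForm_mul, dirDeriv_mul, map_add, h2, h1]
    ring

end IsGaussianFunctional

end SphericalWRLS

end

/-! ### Gaussian integrals in polar coordinates -/

noncomputable section

namespace SphericalWRLS

open MvPolynomial

variable {d : ℕ}

theorem integrable_pow_mul_gaussian (n : ℕ) :
    Integrable fun t : ℝ => t ^ n * Real.exp (-(t ^ 2) / 2) := by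
  have := integrable_rpow_mul_exp_neg_mul_sq (b := 1 / 2) (by norm_num) (s := n)
    (by linarith [(Nat.cast_nonneg n : (0 : ℝ) ≤ n)])
  refine this.congr (Filter.Eventually.of_forall fun t => ?_)
  simp only [Real.rpow_natCast]
  congr 2
  ring

theorem integrable_eval_mul_gaussian (p : MvPolynomial (Fin (d + 1)) ℝ) :
    Integrable fun x : EuclideanSpace ℝ (Fin (d + 1)) =>
      eval (fun i => x i) p * Real.exp (-(‖x‖ ^ 2) / 2) := by
  induction p using MvPolynomial.induction_on' with
  | add p q hp hq =>
    exact (hp.add hq).congr (Filter.Eventually.of_forall fun x => by simp [add_mul])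
  | monomial s a =>
    have h1 : Integrable fun x : Fin (d + 1) → ℝ =>
        a * ∏ i, (x i ^ s i * Real.exp (-(x i ^ 2) / 2)) :=
      (Integrable.fintype_prod (fun i => integrable_pow_mul_gaussian (s i))).const_mul a
    have h2 := (PiLp.volume_preserving_ofLp (Fin (d + 1))).integrable_comp_of_integrable h1
    refine h2.congr (Filter.Eventually.of_forall fun x => ?_)
    simp only [Function.comp_apply, eval_monomial, Finset.prod_mul_distrib, ← Real.exp_sum]
    rw [EuclideanSpace.norm_sq_eq, Finsupp.prod_fintype _ _ (by simp)]
    simp only [Real.norm_eq_abs, sq_abs, ← Finset.sum_div, Finset.sum_neg_distrib, mul_assoc]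

theorem hasLineDerivAt_eval (p : MvPolynomial (Fin (d + 1)) ℝ) (i : Fin (d + 1))
    (x : EuclideanSpace ℝ (Fin (d + 1))) :
    HasLineDerivAt ℝ (fun y : EuclideanSpace ℝ (Fin (d + 1)) => eval (fun j => y j) p)
      (eval (fun j => x j) (pderiv i p)) x (EuclideanSpace.single i 1) := by
  unfold HasLineDerivAt
  induction p using MvPolynomial.induction_on with
  | C a => simpa using hasDerivAt_const (0 : ℝ) a
  | add p q hp hq => simpa using hp.fun_add hq
  | mul_X p j hp =>
    have hX : HasDerivAt (fun t : ℝ => (x + t • EuclideanSpace.single i (1 : ℝ)) j)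
        (eval (fun j => x j) (pderiv i (X j : MvPolynomial (Fin (d + 1)) ℝ))) 0 := by
      have := (((hasDerivAt_id (0 : ℝ)).mul_const
        ((EuclideanSpace.single i (1 : ℝ) : EuclideanSpace ℝ (Fin (d + 1))) j)).const_add (x j))
      refine HasDerivAt.congr_deriv (f := fun t : ℝ =>
        (x + t • EuclideanSpace.single i (1 : ℝ)) j) this ?_
      by_cases hij : i = j <;> simp [pderiv_X, hij, eq_comm]
    have := hp.fun_mul hX
    simp only [map_mul, eval_X]
    refine this.congr_deriv ?_
    simp
    ring

theorem hasLineDerivAt_gaussian (i : Fin (d + 1)) (x : EuclideanSpace ℝ (Fin (d + 1))) :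
    HasLineDerivAt ℝ (fun y : EuclideanSpace ℝ (Fin (d + 1)) => Real.exp (-(‖y‖ ^ 2) / 2))
      (-(x i * Real.exp (-(‖x‖ ^ 2) / 2))) x (EuclideanSpace.single i 1) := by
  unfold HasLineDerivAt
  have h1 : HasDerivAt (fun t : ℝ => x + t • EuclideanSpace.single i (1 : ℝ))
      (EuclideanSpace.single i (1 : ℝ)) 0 := by
    simpa using ((hasDerivAt_id (0 : ℝ)).smul_const
      (EuclideanSpace.single i (1 : ℝ) : EuclideanSpace ℝ (Fin (d + 1)))).const_add x
  have h2 := (h1.norm_sq.neg.div_const 2).exp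
  refine h2.congr_deriv ?_
  simp [EuclideanSpace.inner_single_right]
  ring

/-- Integration against the (unnormalized) Gaussian weight, as a functional on polynomials. -/
def gaussian (d : ℕ) : MvPolynomial (Fin (d + 1)) ℝ →ₗ[ℝ] ℝ where
  toFun p := ∫ x : EuclideanSpace ℝ (Fin (d + 1)),
    eval (fun i => x i) p * Real.exp (-(‖x‖ ^ 2) / 2)
  map_add' p q := by
    rw [← integral_add (integrable_eval_mul_gaussian p) (integrable_eval_mul_gaussian q)]
    simp [add_mul]
  map_smul' a p := by
    simp [smul_eval, mul_assoc, integral_const_mul]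

theorem gaussian_apply (p : MvPolynomial (Fin (d + 1)) ℝ) :
    gaussian d p = ∫ x : EuclideanSpace ℝ (Fin (d + 1)),
      eval (fun i => x i) p * Real.exp (-(‖x‖ ^ 2) / 2) := rfl

/-- The weight satisfies `∂_i e^(-|x|²/2) = -x_i e^(-|x|²/2)`. -/
theorem isGaussianFunctional_gaussian : IsGaussianFunctional (gaussian d) := by
  intro i p
  have h := integral_bilinear_hasLineDerivAt_right_eq_neg_left_of_integrable
    (μ := (volume : Measure (EuclideanSpace ℝ (Fin (d + 1)))))
    (B := ContinuousLinearMap.mul ℝ ℝ) (v := EuclideanSpace.single i 1)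
    (f := fun x : EuclideanSpace ℝ (Fin (d + 1)) => eval (fun j => x j) p)
    (f' := fun x : EuclideanSpace ℝ (Fin (d + 1)) => eval (fun j => x j) (pderiv i p))
    (g := fun x : EuclideanSpace ℝ (Fin (d + 1)) => Real.exp (-(‖x‖ ^ 2) / 2))
    (g' := fun x : EuclideanSpace ℝ (Fin (d + 1)) => -(x i * Real.exp (-(‖x‖ ^ 2) / 2)))
    (by simpa using integrable_eval_mul_gaussian (pderiv i p))
    (by
      refine (integrable_eval_mul_gaussian (X i * p)).neg.congr
        (Filter.Eventually.of_forall fun x => ?_)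
      simp
      ring)
    (by simpa using integrable_eval_mul_gaussian p)
    (fun x _ => hasLineDerivAt_eval p i x) (fun x _ => hasLineDerivAt_gaussian i x)
  rw [gaussian_apply, gaussian_apply]
  simp only [ContinuousLinearMap.mul_apply', mul_neg, integral_neg, neg_inj] at h
  rw [← h]
  refine integral_congr_ae (Filter.Eventually.of_forall fun x => ?_)
  simp
  ring

/-- The radial part of the Gaussian integral of a homogeneous polynomial of degree `m`. -/
def radialMoment (d m : ℕ) : ℝ :=
  ∫ r : Set.Ioi (0 : ℝ), (r : ℝ) ^ m * Real.exp (-((r : ℝ) ^ 2) / 2) ∂Measure.volumeIoiPow d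

theorem radialMoment_pos (d m : ℕ) : 0 < radialMoment d m := by
  have h : radialMoment d m = ∫ r in Set.Ioi (0 : ℝ),
      r ^ ((d + m : ℕ) : ℝ) * Real.exp (-(1 / 2) * r ^ (2 : ℝ)) := by
    simp only [radialMoment, Measure.volumeIoiPow, ENNReal.ofReal]
    rw [integral_withDensity_eq_integral_smul,
      integral_subtype_comap measurableSet_Ioi fun a : ℝ =>
        Real.toNNReal (a ^ d) • (a ^ m * Real.exp (-(a ^ 2) / 2))]
    · refine setIntegral_congr_fun measurableSet_Ioi fun x hx => ?_
      simp only [NNReal.smul_def, smul_eq_mul]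
      rw [Real.coe_toNNReal _ (pow_nonneg (le_of_lt hx) _), ← mul_assoc, ← pow_add,
        Real.rpow_natCast, Real.rpow_two]
      congr 2
      ring
    · exact (measurable_subtype_coe.pow_const _).real_toNNReal
  rw [h, integral_rpow_mul_exp_neg_mul_rpow (by norm_num)
    (by linarith [(Nat.cast_nonneg (d + m) : (0 : ℝ) ≤ (d + m : ℕ))]) (by norm_num)]
  have : 0 < Real.Gamma ((((d + m : ℕ) : ℝ) + 1) / 2) := Real.Gamma_pos_of_pos (by positivity)
  positivity

theorem eval_smul_of_isHomogeneous {m : ℕ} {p : MvPolynomial (Fin (d + 1)) ℝ}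
    (hp : p.IsHomogeneous m) (a : ℝ) (v : Fin (d + 1) → ℝ) :
    eval (fun i => a * v i) p = a ^ m * eval v p := by
  rw [eval_eq', eval_eq', Finset.mul_sum]
  refine Finset.sum_congr rfl fun s hs => ?_
  have hs' : ∑ i, s i = m := by
    rw [← Finsupp.degree_eq_sum, Finsupp.degree_eq_weight_one]
    exact hp (mem_support_iff.1 hs)
  simp only [mul_pow, Finset.prod_mul_distrib, Finset.prod_pow_eq_pow_sum, hs']
  ring

/-- A homogeneous polynomial splits as `r^m` times its restriction to the sphere. As the radial
factor is positive, algebraic identities for the Gaussian functional transfer to the surface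
measure. -/
theorem gaussian_eq_radialMoment_mul {m : ℕ} {p : MvPolynomial (Fin (d + 1)) ℝ}
    (hp : p.IsHomogeneous m) :
    gaussian d p = radialMoment d m * ∫ x, restrictSph d p x ∂(surf d) := by
  set F : EuclideanSpace ℝ (Fin (d + 1)) → ℝ := fun x =>
    eval (fun i => x i) p * Real.exp (-(‖x‖ ^ 2) / 2) with hF
  have hdim : Module.finrank ℝ (EuclideanSpace ℝ (Fin (d + 1))) - 1 = d := by simp
  have h := (volume :
    Measure (EuclideanSpace ℝ (Fin (d + 1)))).measurePreserving_homeomorphUnitSphereProd.integral_comp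
    (Homeomorph.measurableEmbedding _) (fun z : Sph d × Set.Ioi (0 : ℝ) =>
      restrictSph d p z.1 * ((z.2 : ℝ) ^ m * Real.exp (-((z.2 : ℝ) ^ 2) / 2)))
  rw [hdim, integral_prod_mul (restrictSph d p)
    (fun r : Set.Ioi (0 : ℝ) => (r : ℝ) ^ m * Real.exp (-((r : ℝ) ^ 2) / 2))] at h
  rw [mul_comm]
  change _ = (∫ x, restrictSph d p x ∂(volume : Measure _).toSphere) * radialMoment d m
  rw [radialMoment]
  have hg : gaussian d p = ∫ x : ({0}ᶜ : Set (EuclideanSpace ℝ (Fin (d + 1)))), F x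
      ∂(volume : Measure (EuclideanSpace ℝ (Fin (d + 1)))).comap (↑) := by
    rw [integral_subtype_comap (measurableSet_singleton _).compl F, restrict_compl_singleton,
      gaussian_apply]
  rw [hg]
  refine Eq.trans ?_ h
  refine integral_congr_ae (Filter.Eventually.of_forall fun x => ?_)
  have hx : ‖x.1‖ ≠ 0 := norm_ne_zero_iff.2 x.2
  simp only [homeomorphUnitSphereProd_apply_snd_coe, restrictSph, LinearMap.coe_mk, AddHom.coe_mk,
    homeomorphUnitSphereProd_apply_fst_coe, PiLp.smul_apply, smul_eq_mul]
  have hxm : ‖x.1‖ ^ m ≠ 0 := pow_ne_zero _ hx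
  rw [eval_smul_of_isHomogeneous hp, inv_pow, hF]
  field_simp

theorem surf_real_univ (d : ℕ) : (surf d).real Set.univ = sphVol d := by
  rw [surf, Measure.toSphere_real_apply_univ, measureReal_def, EuclideanSpace.volume_ball, sphVol]
  simp only [finrank_euclideanSpace, Fintype.card_fin, ENNReal.ofReal_one, one_pow, one_mul]
  have hpos : (0 : ℝ) < ((d + 1 : ℕ) : ℝ) / 2 := by positivity
  have hG : 0 < Real.Gamma (((d + 1 : ℕ) : ℝ) / 2) := Real.Gamma_pos_of_pos hpos
  rw [Real.Gamma_add_one hpos.ne', ENNReal.toReal_ofReal (by positivity)]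
  have : Real.sqrt Real.pi ^ (d + 1) = Real.pi ^ (((d : ℝ) + 1) / 2) := by
    rw [Real.sqrt_eq_rpow, ← Real.rpow_natCast, ← Real.rpow_mul Real.pi_pos.le]
    congr 1
    push_cast
    ring
  rw [this]
  push_cast at hG ⊢
  field_simp

theorem sphVol_pos (d : ℕ) : 0 < sphVol d := by
  have : 0 < Real.Gamma (((d : ℝ) + 1) / 2) := Real.Gamma_pos_of_pos (by positivity)
  have := Real.pi_pos
  unfold sphVol
  positivity

instance : IsFiniteMeasure (surf d) := by unfold surf; infer_instance

end SphericalWRLS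

end

/-! ### Orthogonality, reproducing property and addition theorem on the sphere -/

noncomputable section

namespace SphericalWRLS

open MvPolynomial

variable {d : ℕ}

theorem restrictSph_apply (p : MvPolynomial (Fin (d + 1)) ℝ) (x : Sph d) :
    restrictSph d p x = eval (fun i => x.1 i) p := rfl

theorem continuous_restrictSph (p : MvPolynomial (Fin (d + 1)) ℝ) :
    Continuous (restrictSph d p) := by
  have h : Continuous fun x : Sph d => fun i => x.1 i := by fun_prop
  exact p.continuous_eval.comp h

theorem mem_sphHarm {k : ℕ} {f : Sph d → ℝ} :
    f ∈ sphHarm d k ↔ ∃ p ∈ solidHarm d k, restrictSph d p = f := Submodule.mem_map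

theorem continuous_of_mem_sphHarm {k : ℕ} {f : Sph d → ℝ} (hf : f ∈ sphHarm d k) :
    Continuous f := by
  obtain ⟨p, -, rfl⟩ := mem_sphHarm.1 hf
  exact continuous_restrictSph p

theorem integrable_surf_of_continuous {f : Sph d → ℝ} (hf : Continuous f) :
    Integrable f (surf d) :=
  hf.integrable_of_hasCompactSupport (HasCompactSupport.of_compactSpace f)

theorem integral_restrictSph_mul {m n : ℕ} {p q : MvPolynomial (Fin (d + 1)) ℝ}
    (hp : p.IsHomogeneous m) (hq : q.IsHomogeneous n) :
    ∫ x, restrictSph d p x * restrictSph d q x ∂(surf d) =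
      (radialMoment d (m + n))⁻¹ * gaussian d (p * q) := by
  rw [gaussian_eq_radialMoment_mul (hp.mul hq), inv_mul_cancel_left₀ (radialMoment_pos d _).ne']
  simp [restrictSph_apply]

theorem integral_mul_sphHarm_eq_zero {j k : ℕ} (hjk : j ≠ k) {f g : Sph d → ℝ}
    (hf : f ∈ sphHarm d j) (hg : g ∈ sphHarm d k) : ∫ x, f x * g x ∂(surf d) = 0 := by
  wlog h : j < k generalizing j k f g
  · rw [← this hjk.symm hg hf (by omega)]
    simp [mul_comm]
  obtain ⟨p, hp, rfl⟩ := mem_sphHarm.1 hf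
  obtain ⟨q, hq, rfl⟩ := mem_sphHarm.1 hg
  rw [integral_restrictSph_mul (mem_solidHarm.1 hp).1 (mem_solidHarm.1 hq).1,
    isGaussianFunctional_gaussian.mul_solidHarm_of_lt h (mem_solidHarm.1 hp).1 hq, mul_zero]

theorem inner_eq_sum (z x : Sph d) : inner ℝ z.1 x.1 = ∑ i, z.1 i * x.1 i := by
  rw [PiLp.inner_apply]
  exact Finset.sum_congr rfl fun i _ => by simp [mul_comm]

theorem inner_self_sph (z : Sph d) : inner ℝ z.1 z.1 = (1 : ℝ) := by
  simp

theorem sum_mul_self_sph (z : Sph d) : ∑ i, z.1 i * z.1 i = 1 := by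
  rw [← inner_eq_sum, inner_self_sph]

theorem inner_mem_Icc (z x : Sph d) : (inner ℝ z.1 x.1 : ℝ) ∈ Set.Icc (-1 : ℝ) 1 := by
  have h := abs_real_inner_le_norm z.1 x.1
  have hz : ‖z.1‖ = 1 := by simp
  have hx : ‖x.1‖ = 1 := by simp
  rw [hz, hx, one_mul] at h
  exact abs_le.1 h

theorem restrictSph_legPoly (z x : Sph d) (k : ℕ) :
    restrictSph d (legPoly (fun i => z.1 i) k) x = legendreP d k (inner ℝ z.1 x.1) := by
  have h1 : eval (fun i => x.1 i) (linForm fun i => z.1 i) = inner ℝ z.1 x.1 := by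
    simp [linForm, inner_eq_sum]
  have h2 : eval (fun i => x.1 i) (normSqPoly d) = 1 := by
    simp [normSqPoly, sum_mul_self_sph]
  rw [restrictSph_apply]
  induction k using Nat.twoStepInduction with
  | zero => simp [legPoly, legendreP]
  | one => simpa [legPoly, legendreP] using h1
  | more k ih0 ih1 =>
    rw [legPoly, legendreP]
    simp only [map_sub, map_mul, eval_C, h1, h2, ih0, ih1]
    ring

theorem legendreP_one (hd : 1 ≤ d) (k : ℕ) : legendreP d k 1 = 1 := by
  have hd' : (1 : ℝ) ≤ d := by exact_mod_cast hd
  induction k using Nat.twoStepInduction with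
  | zero => rfl
  | one => rfl
  | more k ih0 ih1 =>
    rw [legendreP, ih0, ih1]
    have hk0 : ((k : ℝ) + d) ≠ 0 := by positivity
    field_simp
    ring

theorem legendreP_inner_mem_sphHarm (hd : 1 ≤ d) (k : ℕ) (z : Sph d) :
    (fun x : Sph d => legendreP d k (inner ℝ z.1 x.1)) ∈ sphHarm d k :=
  mem_sphHarm.2 ⟨legPoly (fun i => z.1 i) k, legPoly_mem_solidHarm hd (sum_mul_self_sph z) k,
    funext fun x => restrictSph_legPoly z x k⟩

theorem exists_integral_legendreP_mul (hd : 1 ≤ d) (k : ℕ) :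
    ∃ c : ℝ, ∀ z : Sph d, ∀ h ∈ sphHarm d k,
      ∫ x, legendreP d k (inner ℝ z.1 x.1) * h x ∂(surf d) = c * h z := by
  obtain ⟨β, hβ⟩ := (isGaussianFunctional_gaussian (d := d)).exists_legPoly_mul hd k
  refine ⟨(radialMoment d (k + k))⁻¹ * β, fun z h hh => ?_⟩
  obtain ⟨p, hp, rfl⟩ := mem_sphHarm.1 hh
  simp only [← restrictSph_legPoly]
  rw [integral_restrictSph_mul (legPoly_isHomogeneous _ k) (mem_solidHarm.1 hp).1,
    hβ _ (sum_mul_self_sph z) p hp, restrictSph_apply, mul_assoc]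

namespace IsHarmONB

variable {Y : (k : ℕ) → Fin (harmDim d k) → Sph d → ℝ}

theorem mem_sphHarm (hY : IsHarmONB d Y) (k : ℕ) (l : Fin (harmDim d k)) :
    Y k l ∈ sphHarm d k := by
  rw [← hY.span_eq]
  exact Submodule.subset_span ⟨l, rfl⟩

theorem continuous (hY : IsHarmONB d Y) (k : ℕ) (l : Fin (harmDim d k)) : Continuous (Y k l) :=
  continuous_of_mem_sphHarm (hY.mem_sphHarm k l)

theorem eq_sum (hY : IsHarmONB d Y) {k : ℕ} {f : Sph d → ℝ} (hf : f ∈ sphHarm d k) (x : Sph d) :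
    f x = ∑ l, (∫ z, f z * Y k l z ∂(surf d)) * Y k l x := by
  rw [← hY.span_eq, Submodule.mem_span_range_iff_exists_fun] at hf
  obtain ⟨a, rfl⟩ := hf
  have ha : ∀ l, ∫ z, (∑ i, a i • Y k i) z * Y k l z ∂(surf d) = a l := by
    intro l
    simp only [Finset.sum_apply, Pi.smul_apply, smul_eq_mul, Finset.sum_mul, mul_assoc]
    rw [integral_finsetSum]
    · simp [integral_const_mul, hY.orthonormal]
    · exact fun i _ => integrable_surf_of_continuous
        (continuous_const.mul ((hY.continuous k i).mul (hY.continuous k l)))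
  simp only [ha]
  simp

/-- Since `P_k(z · x)` reproduces harmonics up to a constant `c`, its coefficients in the basis are
`c Y_{k,ℓ}(z)`. On the diagonal this reads `1 = c ∑ Y²`, whose integral `Ω_d = c d_k` determines `c`
and shows that neither factor vanishes. -/
theorem addition_theorem (hY : IsHarmONB d Y) (hd : 1 ≤ d) (k : ℕ) (z x : Sph d) :
    ∑ l, Y k l z * Y k l x = harmDim d k / sphVol d * legendreP d k (inner ℝ z.1 x.1) := by
  obtain ⟨c, hc⟩ := exists_integral_legendreP_mul hd k
  have h1 : ∀ z x : Sph d, legendreP d k (inner ℝ z.1 x.1) = c * ∑ l, Y k l z * Y k l x := by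
    intro z x
    rw [hY.eq_sum (legendreP_inner_mem_sphHarm hd k z) x, Finset.mul_sum]
    refine Finset.sum_congr rfl fun l _ => ?_
    rw [hc z _ (hY.mem_sphHarm k l), mul_assoc]
  have h2 : ∀ x : Sph d, 1 = c * ∑ l, Y k l x * Y k l x := fun x => by
    rw [← h1, inner_self_sph, legendreP_one hd]
  have h3 : sphVol d = c * harmDim d k := by
    calc sphVol d = ∫ _x, (1 : ℝ) ∂(surf d) := by simp [surf_real_univ]
      _ = ∫ x, c * ∑ l, Y k l x * Y k l x ∂(surf d) := by simp only [← h2]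
      _ = c * harmDim d k := by
        rw [integral_const_mul, integral_finsetSum]
        · simp [hY.orthonormal]
        · exact fun i _ => integrable_surf_of_continuous
            ((hY.continuous k i).mul (hY.continuous k i))
  have hne : c * harmDim d k ≠ 0 := h3 ▸ (sphVol_pos d).ne'
  rw [h1, h3]
  have hc0 : c ≠ 0 := left_ne_zero_of_mul hne
  have hd0 : (harmDim d k : ℝ) ≠ 0 := right_ne_zero_of_mul hne
  field_simp

theorem sum_sq (hY : IsHarmONB d Y) (hd : 1 ≤ d) (k : ℕ) (x : Sph d) :
    ∑ l, Y k l x ^ 2 = harmDim d k / sphVol d := by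
  simp only [sq]
  rw [hY.addition_theorem hd, inner_self_sph, legendreP_one hd, mul_one]

theorem abs_sum_mul_le (hY : IsHarmONB d Y) (hd : 1 ≤ d) (k : ℕ) (z x : Sph d) :
    |∑ l, Y k l z * Y k l x| ≤ harmDim d k / sphVol d := by
  have h := Finset.sum_mul_sq_le_sq_mul_sq Finset.univ (fun l => Y k l z) (fun l => Y k l x)
  rw [hY.sum_sq hd, hY.sum_sq hd, ← sq] at h
  exact abs_le_of_sq_le_sq h (by have := sphVol_pos d; positivity)

end IsHarmONB

end SphericalWRLS

end

/-! ### Dimension bound for spherical harmonics -/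

noncomputable section

namespace SphericalWRLS

open MvPolynomial

variable {d : ℕ}

theorem coeff_pderiv_pderiv (p : MvPolynomial (Fin (d + 1)) ℝ) (i : Fin (d + 1))
    (t : Fin (d + 1) →₀ ℕ) :
    MvPolynomial.coeff t (pderiv i (pderiv i p)) =
      ((t i : ℝ) + 1) * (t i + 2) * MvPolynomial.coeff (t + Finsupp.single i 2) p := by
  rw [coeff_pderiv, coeff_pderiv, add_assoc, ← Finsupp.single_add]
  simp
  ring

/-- A harmonic polynomial is determined by its Cauchy data on the hyperplane `x₀ = 0`. -/
theorem solidHarm_eq_zero_of_cauchy_data {k : ℕ} {p : MvPolynomial (Fin (d + 1)) ℝ}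
    (hp : p ∈ solidHarm d k)
    (h : ∀ s : Fin (d + 1) →₀ ℕ, s.degree = k → s 0 < 2 → MvPolynomial.coeff s p = 0) :
    p = 0 := by
  obtain ⟨hhom, hharm⟩ := mem_solidHarm.1 hp
  have key : ∀ n : ℕ, ∀ s : Fin (d + 1) →₀ ℕ, s.degree = k → s 0 = n →
      MvPolynomial.coeff s p = 0 := by
    intro n
    induction n using Nat.strong_induction_on with
    | _ n ih =>
      intro s hs hn
      by_cases h2 : s 0 < 2
      · exact h s hs h2
      set t : Fin (d + 1) →₀ ℕ := s - Finsupp.single 0 2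
      have hst : t + Finsupp.single 0 2 = s := by
        rw [tsub_add_cancel_of_le]
        rw [Finsupp.single_le_iff]
        omega
      have ht0 : t 0 + 2 = n := by rw [← hn, ← hst]; simp
      have htd : t.degree + 2 = k := by rw [← hs, ← hst, map_add]; simp
      -- The `t`-coefficient of `Δp = 0` expresses the coefficient at `t + 2e_0 = s` through those
      -- at `t + 2e_i` with `i ≠ 0`, whose exponent of `x₀` is smaller by two.
      have hL := congrArg (MvPolynomial.coeff t) hharm
      rw [polyLaplacian_apply, coeff_sum, MvPolynomial.coeff_zero,
        Finset.sum_eq_single_of_mem 0 (Finset.mem_univ _), coeff_pderiv_pderiv, hst] at hL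
      · have : ((t 0 : ℝ) + 1) * (t 0 + 2) ≠ 0 := by positivity
        exact (mul_eq_zero.1 hL).resolve_left this
      · intro i _ hi
        rw [coeff_pderiv_pderiv, ih (t 0) (by omega) _ (by rw [map_add]; simpa using htd)
          (by simp [hi]), mul_zero]
  ext s
  rw [MvPolynomial.coeff_zero]
  by_contra hne
  refine hne (key _ s ?_ rfl)
  rw [Finsupp.degree_eq_weight_one]
  exact hhom hne

/-- The exponent of total degree `k` with prescribed exponents of all variables but the last. -/
def cauchyExponent (e k : ℕ) (ab : Fin 2 × (Fin e → Fin (k + 1))) : Fin (e + 1 + 1) →₀ ℕ :=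
  Finsupp.equivFunOnFinite.symm
    (Fin.cons (ab.1 : ℕ) (Fin.snoc (α := fun _ => ℕ) (fun i => (ab.2 i : ℕ))
      (k - ab.1 - ∑ i, (ab.2 i : ℕ))))

theorem exists_cauchyExponent_eq {e k : ℕ} {s : Fin (e + 1 + 1) →₀ ℕ} (hs : s.degree = k)
    (h0 : s 0 < 2) : ∃ ab, cauchyExponent e k ab = s := by
  have hsum : s 0 + (∑ i : Fin e, s i.castSucc.succ + s (Fin.last (e + 1))) = k := by
    rw [← hs, Finsupp.degree_eq_sum, Fin.sum_univ_succ, Fin.sum_univ_castSucc]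
    rfl
  have hle : ∀ i : Fin e, s i.castSucc.succ < k + 1 := fun i => by
    have := Finset.single_le_sum (f := fun i : Fin e => s i.castSucc.succ)
      (fun _ _ => Nat.zero_le _) (Finset.mem_univ i)
    omega
  refine ⟨(⟨s 0, h0⟩, fun i => ⟨s i.castSucc.succ, hle i⟩), ?_⟩
  ext i
  refine Fin.cases ?_ (fun j => ?_) i
  · simp [cauchyExponent]
  · refine Fin.lastCases ?_ (fun j => ?_) j
    · simp [cauchyExponent]
      omega
    · simp [cauchyExponent]

/-- A harmonic polynomial is determined by its coefficients with `x₀`-exponent 0 or 1. There are two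
choices for that exponent, at most `k + 1` for each of the `d - 1` middle ones, and the last is
fixed by the total degree. -/
theorem harmDim_le (hd : 1 ≤ d) (k : ℕ) : harmDim d k ≤ 2 * (k + 1) ^ (d - 1) := by
  obtain ⟨e, rfl⟩ : ∃ e, d = e + 1 := ⟨d - 1, by omega⟩
  let Φ : solidHarm (e + 1) k →ₗ[ℝ] (Fin 2 × (Fin e → Fin (k + 1)) → ℝ) :=
    LinearMap.pi fun ab => (lcoeff ℝ (cauchyExponent e k ab)) ∘ₗ (solidHarm (e + 1) k).subtype
  have hΦ : Function.Injective Φ := by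
    rw [← LinearMap.ker_eq_bot, LinearMap.ker_eq_bot']
    intro p hp
    apply Subtype.ext
    refine solidHarm_eq_zero_of_cauchy_data p.2 fun s hs h0 => ?_
    obtain ⟨ab, rfl⟩ := exists_cauchyExponent_eq hs h0
    exact congrFun hp ab
  have hfin : Module.Finite ℝ (solidHarm (e + 1) k) := Module.Finite.of_injective Φ hΦ
  calc harmDim (e + 1) k ≤ Module.finrank ℝ (solidHarm (e + 1) k) :=
        Submodule.finrank_map_le (restrictSph (e + 1)) (solidHarm (e + 1) k)
    _ ≤ Module.finrank ℝ (Fin 2 × (Fin e → Fin (k + 1)) → ℝ) :=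
        LinearMap.finrank_le_finrank_of_injective hΦ
    _ = 2 * (k + 1) ^ (e + 1 - 1) := by simp

end SphericalWRLS

end

/-! ### Fourier expansions, native space and the feature map -/

noncomputable section

namespace SphericalWRLS

variable {d : ℕ} {Y : (k : ℕ) → Fin (harmDim d k) → Sph d → ℝ}

namespace IsHarmONB

theorem sum_mem_sphHarm (hY : IsHarmONB d Y) (k : ℕ) (b : Fin (harmDim d k) → ℝ) :
    (fun x => ∑ l, b l * Y k l x) ∈ sphHarm d k := by
  have h : (fun x => ∑ l, b l * Y k l x) = ∑ l, b l • Y k l := by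
    ext x; simp
  rw [h]
  exact Submodule.sum_mem _ fun l _ => Submodule.smul_mem _ _ (hY.mem_sphHarm k l)

theorem integral_sum_mul (hY : IsHarmONB d Y) (k : ℕ) (b : Fin (harmDim d k) → ℝ)
    (l : Fin (harmDim d k)) :
    ∫ x, (∑ i, b i * Y k i x) * Y k l x ∂(surf d) = b l := by
  simp only [Finset.sum_mul, mul_assoc]
  rw [integral_finsetSum]
  · simp [integral_const_mul, hY.orthonormal]
  · exact fun i _ => integrable_surf_of_continuous
      (continuous_const.mul ((hY.continuous k i).mul (hY.continuous k l)))

/-- A uniformly and absolutely convergent expansion in spherical harmonics is the Fourier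
expansion. -/
theorem fourier_eq_of_hasSum (hY : IsHarmONB d Y) {B : (k : ℕ) → Fin (harmDim d k) → ℝ}
    {u : ℕ → ℝ} (hu : Summable u) (hB : ∀ k x, |∑ l, B k l * Y k l x| ≤ u k)
    {f : Sph d → ℝ} (hf : ∀ x, HasSum (fun k => ∑ l, B k l * Y k l x) (f x))
    (k : ℕ) (l : Fin (harmDim d k)) : fourier Y f k l = B k l := by
  have hint : ∀ j, Integrable (fun x => (∑ i, B j i * Y j i x) * Y k l x) (surf d) := fun j =>
    integrable_surf_of_continuous
      ((continuous_of_mem_sphHarm (hY.sum_mem_sphHarm j (B j))).mul (hY.continuous k l))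
  have hYint : Integrable (fun x => |Y k l x|) (surf d) :=
    integrable_surf_of_continuous (hY.continuous k l).abs
  have hsum : Summable fun j => ∫ x, ‖(∑ i, B j i * Y j i x) * Y k l x‖ ∂(surf d) := by
    refine Summable.of_nonneg_of_le (fun j => integral_nonneg fun x => norm_nonneg _) (fun j => ?_)
      (hu.mul_right (∫ x, |Y k l x| ∂(surf d)))
    rw [← integral_const_mul]
    refine integral_mono (hint j).norm (hYint.const_mul _) fun x => ?_
    simp only [norm_mul, Real.norm_eq_abs]
    exact mul_le_mul_of_nonneg_right (hB j x) (abs_nonneg _)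
  have h := hasSum_integral_of_summable_integral_norm hint hsum
  have hval : ∀ j, ∫ x, (∑ i, B j i * Y j i x) * Y k l x ∂(surf d) =
      if j = k then B k l else 0 := by
    intro j
    split_ifs with hjk
    · subst hjk
      exact hY.integral_sum_mul j (B j) l
    · exact integral_mul_sphHarm_eq_zero hjk (hY.sum_mem_sphHarm j (B j)) (hY.mem_sphHarm k l)
  simp only [hval] at h
  rw [← h.unique (hasSum_ite_eq k (B k l))]
  refine integral_congr_ae (Filter.Eventually.of_forall fun x => ?_)
  exact ((hf x).mul_right (Y k l x)).tsum_eq.symm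

theorem abs_sum_sample_mul_le (hY : IsHarmONB d Y) (hd : 1 ≤ d) {N : ℕ} (x : Fin N → Sph d)
    (c : Fin N → ℝ) (k : ℕ) (z : Sph d) :
    |∑ l, (∑ i, c i * Y k l (x i)) * Y k l z| ≤ (∑ i, |c i|) * (harmDim d k / sphVol d) := by
  have h : ∑ l, (∑ i, c i * Y k l (x i)) * Y k l z =
      ∑ i, c i * ∑ l, Y k l (x i) * Y k l z := by
    simp only [Finset.sum_mul, Finset.mul_sum, mul_assoc]
    exact Finset.sum_comm
  rw [h, Finset.sum_mul]
  refine (Finset.abs_sum_le_sum_abs _ _).trans (Finset.sum_le_sum fun i _ => ?_)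
  rw [abs_mul]
  exact mul_le_mul_of_nonneg_left (hY.abs_sum_mul_le hd k _ _) (abs_nonneg _)

/-- The left side is the quadratic form of the kernel `∑ Y(x_i) Y(x_j)` at `c`, whose entries are
bounded by its diagonal value. -/
theorem sum_sample_sq_le (hY : IsHarmONB d Y) (hd : 1 ≤ d) {N : ℕ} (x : Fin N → Sph d)
    (c : Fin N → ℝ) (k : ℕ) :
    ∑ l, (∑ i, c i * Y k l (x i)) ^ 2 ≤ (∑ i, |c i|) ^ 2 * (harmDim d k / sphVol d) := by
  have h : ∑ l, (∑ i, c i * Y k l (x i)) ^ 2 =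
      ∑ j, c j * ∑ l, (∑ i, c i * Y k l (x i)) * Y k l (x j) := by
    have hj : ∀ j, c j * ∑ l, (∑ i, c i * Y k l (x i)) * Y k l (x j) =
        ∑ l, c j * ((∑ i, c i * Y k l (x i)) * Y k l (x j)) := fun j => Finset.mul_sum _ _ _
    simp only [hj]
    rw [Finset.sum_comm]
    refine Finset.sum_congr rfl fun l _ => ?_
    rw [sq, Finset.mul_sum]
    exact Finset.sum_congr rfl fun j _ => by ring
  rw [h, sq, mul_assoc, Finset.sum_mul]
  refine (le_abs_self _).trans ((Finset.abs_sum_le_sum_abs _ _).trans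
    (Finset.sum_le_sum fun j _ => ?_))
  rw [abs_mul]
  exact mul_le_mul_of_nonneg_left (hY.abs_sum_sample_mul_le hd x c k _) (abs_nonneg _)

variable {φ : ℝ → ℝ}

theorem hasSum_kernelAt (hY : IsHarmONB d Y) (hd : 1 ≤ d) (hφ : IsPosDefSBF d φ) (z x : Sph d) :
    HasSum (fun k => coeff d φ k * ∑ l, Y k l z * Y k l x) (kernelAt d φ z x) := by
  have h : HasSum _ (kernelAt d φ z x) := hφ.expansion _ (inner_mem_Icc z x)
  simpa only [hY.addition_theorem hd, mul_assoc] using h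

theorem hasSum_sum_kernelAt (hY : IsHarmONB d Y) (hd : 1 ≤ d) (hφ : IsPosDefSBF d φ) {N : ℕ}
    (x : Fin N → Sph d) (c : Fin N → ℝ) (z : Sph d) :
    HasSum (fun k => ∑ l, (coeff d φ k * ∑ i, c i * Y k l (x i)) * Y k l z)
      ((∑ i, c i • kernelAt d φ (x i)) z) := by
  have h := hasSum_sum (s := Finset.univ)
    fun (i : Fin N) _ => (hY.hasSum_kernelAt hd hφ (x i) z).mul_left (c i)
  have hk : ∀ k, ∑ l, (coeff d φ k * ∑ i, c i * Y k l (x i)) * Y k l z =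
      ∑ i, c i * (coeff d φ k * ∑ l, Y k l (x i) * Y k l z) := fun k => by
    simp only [Finset.mul_sum, Finset.sum_mul]
    rw [Finset.sum_comm]
    exact Finset.sum_congr rfl fun i _ => Finset.sum_congr rfl fun l _ => by ring
  have hz : (∑ i, c i • kernelAt d φ (x i)) z = ∑ i, c i * kernelAt d φ (x i) z := by
    rw [Finset.sum_apply]; rfl
  simp only [hk]
  rw [hz]
  exact h

/-- Functions whose Fourier coefficients are those of a combination of kernel sections, damped by
a bounded multiplier, belong to the native space. -/
theorem memNative_of_multiplier (hY : IsHarmONB d Y) (hd : 1 ≤ d) (hφ : IsPosDefSBF d φ) {N : ℕ}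
    (x : Fin N → Sph d) (c : Fin N → ℝ) {θ : ℕ → ℝ} {R : ℝ} (hθ : ∀ k, |θ k| ≤ R)
    {f : Sph d → ℝ}
    (hf : ∀ z, f z = ∑' k, θ k * ∑ l, (coeff d φ k * ∑ i, c i * Y k l (x i)) * Y k l z) :
    (∀ k l, fourier Y f k l = θ k * (coeff d φ k * ∑ i, c i * Y k l (x i))) ∧
      MemNative Y φ f := by
  have hR : 0 ≤ R := (abs_nonneg _).trans (hθ 0)
  set B : (k : ℕ) → Fin (harmDim d k) → ℝ :=
    fun k l => θ k * (coeff d φ k * ∑ i, c i * Y k l (x i)) with hB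
  have hBsum : ∀ k z, ∑ l, B k l * Y k l z =
      θ k * (coeff d φ k * ∑ l, (∑ i, c i * Y k l (x i)) * Y k l z) := fun k z => by
    simp only [hB, Finset.mul_sum (s := (Finset.univ : Finset (Fin (harmDim d k)))), mul_assoc]
  have hBf : ∀ k z, θ k * ∑ l, (coeff d φ k * ∑ i, c i * Y k l (x i)) * Y k l z =
      ∑ l, B k l * Y k l z := fun k z => by
    simp only [hB, Finset.mul_sum (s := (Finset.univ : Finset (Fin (harmDim d k)))), mul_assoc]
  set u : ℕ → ℝ := fun k => R * (∑ i, |c i|) * (coeff d φ k * (harmDim d k / sphVol d)) with hu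
  have husum : Summable u := hφ.summable.mul_left _
  have hBu : ∀ k z, |∑ l, B k l * Y k l z| ≤ u k := fun k z => by
    rw [hBsum, abs_mul, abs_mul, abs_of_pos (hφ.coeff_pos k), hu]
    calc |θ k| * (coeff d φ k * |∑ l, (∑ i, c i * Y k l (x i)) * Y k l z|)
        ≤ R * (coeff d φ k * ((∑ i, |c i|) * (harmDim d k / sphVol d))) := by
          have := (hφ.coeff_pos k).le
          have h1 := hY.abs_sum_sample_mul_le hd x c k z
          have h2 := hθ k
          gcongr
      _ = _ := by ring
  have hfs : ∀ z, HasSum (fun k => ∑ l, B k l * Y k l z) (f z) := fun z => by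
    rw [hf z]
    simp only [hBf]
    exact (Summable.of_norm_bounded husum fun k => hBu k z).hasSum
  have hfour := hY.fourier_eq_of_hasSum husum hBu hfs
  refine ⟨hfour, fun z => by simpa only [hfour] using hfs z, ?_⟩
  simp only [hfour]
  refine Summable.of_nonneg_of_le (fun k => ?_) (fun k => ?_)
    (hφ.summable.mul_left (R ^ 2 * (∑ i, |c i|) ^ 2))
  · exact mul_nonneg (inv_nonneg.2 (hφ.coeff_pos k).le) (Finset.sum_nonneg fun l _ => sq_nonneg _)
  · have hpos := hφ.coeff_pos k
    -- The inverse weight removes one of the two factors `φ̂_k`, so the summability of `φ̂_k d_k /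
    -- Ω_d` suffices.
    have h1 : (coeff d φ k)⁻¹ * ∑ l, B k l ^ 2 =
        θ k ^ 2 * (coeff d φ k * ∑ l, (∑ i, c i * Y k l (x i)) ^ 2) := by
      simp only [hB, mul_pow, ← Finset.mul_sum (s := (Finset.univ : Finset (Fin (harmDim d k))))]
      field_simp
    rw [h1]
    have h2 : θ k ^ 2 ≤ R ^ 2 := sq_le_sq' (by linarith [abs_le.1 (hθ k)]) (abs_le.1 (hθ k)).2
    calc θ k ^ 2 * (coeff d φ k * ∑ l, (∑ i, c i * Y k l (x i)) ^ 2)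
        ≤ R ^ 2 * (coeff d φ k * ((∑ i, |c i|) ^ 2 * (harmDim d k / sphVol d))) := by
          have h3 := hY.sum_sample_sq_le hd x c k
          gcongr
      _ = _ := by ring

theorem memNative_sum_kernelAt (hY : IsHarmONB d Y) (hd : 1 ≤ d) (hφ : IsPosDefSBF d φ) {N : ℕ}
    (x : Fin N → Sph d) (c : Fin N → ℝ) :
    (∀ k l, fourier Y (∑ i, c i • kernelAt d φ (x i)) k l =
        coeff d φ k * ∑ i, c i * Y k l (x i)) ∧
      MemNative Y φ (∑ i, c i • kernelAt d φ (x i)) := by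
  have h := hY.memNative_of_multiplier hd hφ x c (θ := fun _ => 1) (R := 1) (by simp)
    (f := ∑ i, c i • kernelAt d φ (x i)) fun z => by
      simpa only [one_mul] using (hY.hasSum_sum_kernelAt hd hφ x c z).tsum_eq.symm
  simpa only [one_mul] using h

theorem memNative_invSqrt (hY : IsHarmONB d Y) (hd : 1 ≤ d) (hφ : IsPosDefSBF d φ) {N : ℕ}
    (x : Fin N → Sph d) (c : Fin N → ℝ) {lam : ℝ} (hlam : 0 < lam) :
    (∀ k l, fourier Y (invSqrt Y φ lam (∑ i, c i • kernelAt d φ (x i))) k l =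
        (coeff d φ k + lam) ^ (-(1 / 2) : ℝ) * (coeff d φ k * ∑ i, c i * Y k l (x i))) ∧
      MemNative Y φ (invSqrt Y φ lam (∑ i, c i • kernelAt d φ (x i))) := by
  refine hY.memNative_of_multiplier hd hφ x c (R := lam ^ (-(1 / 2) : ℝ)) (fun k => ?_) fun z => ?_
  · have := hφ.coeff_pos k
    rw [abs_of_pos (by positivity)]
    exact Real.rpow_le_rpow_of_nonpos hlam (by linarith) (by norm_num)
  · simp only [invSqrt, specCalc, (hY.memNative_sum_kernelAt hd hφ x c).1]

theorem summable_feature_sq (hY : IsHarmONB d Y) (hd : 1 ≤ d) {ρ : ℕ → ℝ} (hρ : ∀ k, 0 ≤ ρ k)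
    (hsum : Summable fun k => ρ k * (harmDim d k / sphVol d)) (z : Sph d) :
    Summable fun p : Σ k, Fin (harmDim d k) => ‖Real.sqrt (ρ p.1) * Y p.1 p.2 z‖ ^ 2 := by
  rw [summable_sigma_of_nonneg fun _ => sq_nonneg _]
  refine ⟨fun k => (hasSum_fintype _).summable, hsum.congr fun k => ?_⟩
  rw [tsum_fintype, ← hY.sum_sq hd k z, Finset.mul_sum]
  simp [mul_pow, Real.sq_sqrt (hρ k)]

/-- The feature map `z ↦ (√ρ_k Y_{k,ℓ}(z))_{k,ℓ}` into `ℓ²`. -/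
def feature (hY : IsHarmONB d Y) (hd : 1 ≤ d) {ρ : ℕ → ℝ} (hρ : ∀ k, 0 ≤ ρ k)
    (hsum : Summable fun k => ρ k * (harmDim d k / sphVol d)) (z : Sph d) :
    lp (fun _ : Σ k, Fin (harmDim d k) => ℝ) 2 :=
  ⟨fun p => Real.sqrt (ρ p.1) * Y p.1 p.2 z, memℓp_gen (by
    simpa using hY.summable_feature_sq hd hρ hsum z)⟩

theorem norm_sum_feature_sq (hY : IsHarmONB d Y) (hd : 1 ≤ d) {ρ : ℕ → ℝ} (hρ : ∀ k, 0 ≤ ρ k)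
    (hsum : Summable fun k => ρ k * (harmDim d k / sphVol d)) {N : ℕ} (x : Fin N → Sph d)
    (c : Fin N → ℝ) :
    ‖∑ i, c i • hY.feature hd hρ hsum (x i)‖ ^ 2 =
      ∑' k, ρ k * ∑ l, (∑ i, c i * Y k l (x i)) ^ 2 := by
  have h := lp.norm_rpow_eq_tsum (p := 2) (by simp) (∑ i, c i • hY.feature hd hρ hsum (x i))
  have hs := (lp.memℓp (∑ i, c i • hY.feature hd hρ hsum (x i))).summable (by simp)
  simp only [ENNReal.toReal_ofNat, Real.rpow_two] at h hs
  rw [h, hs.tsum_sigma]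
  refine tsum_congr fun k => ?_
  rw [tsum_fintype, Finset.mul_sum]
  refine Finset.sum_congr rfl fun l _ => ?_
  have hv : (∑ i, c i • hY.feature hd hρ hsum (x i) : lp (fun _ : Σ k, Fin (harmDim d k) => ℝ) 2)
      ⟨k, l⟩ = Real.sqrt (ρ k) * ∑ i, c i * Y k l (x i) := by
    rw [lp.coeFn_sum, Finset.sum_apply, Finset.mul_sum]
    refine Finset.sum_congr rfl fun i _ => ?_
    rw [lp.coeFn_smul, Pi.smul_apply, smul_eq_mul, feature]
    ring
  rw [hv, Real.norm_eq_abs, sq_abs, mul_pow, Real.sq_sqrt (hρ k)]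

/-- By the addition theorem on the diagonal, the norm is the same at every point. With `ρ_k = φ̂_k /
(φ̂_k + λ)` it is the effective dimension. -/
theorem norm_feature_sq (hY : IsHarmONB d Y) (hd : 1 ≤ d) {ρ : ℕ → ℝ} (hρ : ∀ k, 0 ≤ ρ k)
    (hsum : Summable fun k => ρ k * (harmDim d k / sphVol d)) (z : Sph d) :
    ‖hY.feature hd hρ hsum z‖ ^ 2 = ∑' k, ρ k * (harmDim d k / sphVol d) := by
  have h := hY.norm_sum_feature_sq hd hρ hsum (fun _ : Fin 1 => z) (fun _ => 1)
  simpa [hY.sum_sq hd] using h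

/-- The weights combine as `φ̂⁻¹ · (φ̂ + λ)⁻¹ · φ̂² = φ̂ / (φ̂ + λ)`. This moves the question into
`ℓ²`, where Hilbert space concentration applies. -/
theorem nativeNorm_invSqrt (hY : IsHarmONB d Y) (hd : 1 ≤ d) (hφ : IsPosDefSBF d φ)
    {lam : ℝ} (hlam : 0 < lam) {N : ℕ} (x : Fin N → Sph d) (c : Fin N → ℝ)
    (hρ : ∀ k, 0 ≤ coeff d φ k / (coeff d φ k + lam))
    (hsum : Summable fun k => coeff d φ k / (coeff d φ k + lam) * (harmDim d k / sphVol d)) :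
    nativeNorm Y φ (invSqrt Y φ lam (∑ i, c i • kernelAt d φ (x i))) =
      ‖∑ i, c i • hY.feature hd hρ hsum (x i)‖ := by
  rw [nativeNorm, ← Real.sqrt_sq (norm_nonneg (∑ i, c i • hY.feature hd hρ hsum (x i))),
    hY.norm_sum_feature_sq hd hρ hsum]
  congr 1
  refine tsum_congr fun k => ?_
  have hpos := hφ.coeff_pos k
  have hpos' : 0 < coeff d φ k + lam := by positivity
  have h2 : ((coeff d φ k + lam) ^ (-(1 / 2) : ℝ)) ^ 2 = (coeff d φ k + lam)⁻¹ := by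
    rw [← Real.rpow_natCast, ← Real.rpow_mul hpos'.le, ← Real.rpow_neg_one]
    norm_num
  simp only [(hY.memNative_invSqrt hd hφ x c hlam).1, mul_pow, h2,
    ← Finset.mul_sum (s := (Finset.univ : Finset (Fin (harmDim d k))))]
  field_simp

end IsHarmONB

end SphericalWRLS

end

/-! ### Concentration of sums of random multiples of fixed vectors in a Hilbert space -/

noncomputable section

namespace SphericalWRLS

section Concentration

variable {H : Type*} [NormedAddCommGroup H] [InnerProductSpace ℝ H]

/-- A second-order Taylor bound: `√(1 + ‖x‖²)` is a smooth substitute for the norm, with gradient of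
norm at most 1 and Hessian at most the identity. -/
theorem sqrt_one_add_norm_add_sq_le (x v : H) :
    Real.sqrt (1 + ‖x + v‖ ^ 2) ≤ Real.sqrt (1 + ‖x‖ ^ 2) +
      inner ℝ x v / Real.sqrt (1 + ‖x‖ ^ 2) + ‖v‖ ^ 2 / 2 := by
  set r := Real.sqrt (1 + ‖x‖ ^ 2) with hr
  have hr2 : r ^ 2 = 1 + ‖x‖ ^ 2 := Real.sq_sqrt (by positivity)
  have hr1 : 1 ≤ r := by rw [hr]; exact Real.one_le_sqrt.2 (by nlinarith [sq_nonneg ‖x‖])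
  have hxr : ‖x‖ ≤ r := by rw [hr]; exact Real.le_sqrt_of_sq_le (by linarith)
  have hin : |inner ℝ x v / r| ≤ ‖v‖ := by
    rw [abs_div, abs_of_pos (by linarith : 0 < r), div_le_iff₀ (by linarith)]
    calc |inner ℝ x v| ≤ ‖x‖ * ‖v‖ := abs_real_inner_le_norm x v
      _ ≤ r * ‖v‖ := by gcongr
      _ = ‖v‖ * r := mul_comm _ _
  have hmul : r * (inner ℝ x v / r) = inner ℝ x v := by field_simp
  -- Squaring requires a nonnegative right side, which is at least `1 - ‖v‖ + ‖v‖²/2`.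
  have hnn : 0 ≤ r + inner ℝ x v / r + ‖v‖ ^ 2 / 2 := by
    nlinarith [abs_le.1 hin, sq_nonneg (‖v‖ - 1)]
  refine Real.sqrt_le_iff.2 ⟨hnn, ?_⟩
  rw [norm_add_sq_real]
  nlinarith [sq_nonneg (inner ℝ x v / r + ‖v‖ ^ 2 / 2), sq_nonneg ‖v‖,
    mul_nonneg (sub_nonneg.2 hr1) (sq_nonneg ‖v‖)]

variable {Ω : Type*} [MeasurableSpace Ω] {P : Measure Ω} [IsProbabilityMeasure P]

/-- Hoeffding's lemma: an interval of length `2M` gives variance proxy `M²`. -/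
theorem lintegral_exp_mul_le {X : Ω → ℝ} (hX : Measurable X) {M : ℝ}
    (hM : ∀ᵐ ω ∂P, |X ω| ≤ M) (h0 : ∫ ω, X ω ∂P = 0) (t : ℝ) :
    ∫⁻ ω, ENNReal.ofReal (Real.exp (t * X ω)) ∂P ≤
      ENNReal.ofReal (Real.exp (M ^ 2 * t ^ 2 / 2)) := by
  have h := hasSubgaussianMGF_of_mem_Icc_of_integral_eq_zero (a := -M) (b := M) hX.aemeasurable
    (hM.mono fun ω h => abs_le.1 h) h0
  rw [← ofReal_integral_eq_lintegral_ofReal (h.integrable_exp_mul t)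
    (Filter.Eventually.of_forall fun ω => (Real.exp_pos _).le)]
  refine ENNReal.ofReal_le_ofReal ((h.mgf_le t).trans_eq ?_)
  congr 3
  push_cast
  rw [Real.norm_eq_abs, div_pow, sq_abs]
  ring

variable {ι : Type*} {ε : ι → Ω → ℝ}

/-- Exponential moments of the (smoothed) norm of a sum of independent bounded centred vectors on
fixed lines of a Hilbert space. -/
theorem lintegral_exp_sqrt_le (hε : ∀ i, Measurable (ε i)) (hind : iIndepFun ε P)
    (h0 : ∀ i, ∫ ω, ε i ω ∂P = 0) {M : ℝ} (hM : ∀ i, ∀ᵐ ω ∂P, |ε i ω| ≤ M) (u : ι → H)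
    (s : Finset ι) :
    ∫⁻ ω, ENNReal.ofReal (Real.exp (Real.sqrt (1 + ‖∑ i ∈ s, ε i ω • u i‖ ^ 2))) ∂P ≤
      ENNReal.ofReal (Real.exp (1 + M ^ 2 * ∑ i ∈ s, ‖u i‖ ^ 2)) := by
  classical
  induction s using Finset.induction_on with
  | empty => simp
  | insert j s hj ih =>
    -- The variables already summed are frozen at `v`. The smoothed norm then grows by at most a
    -- term linear in the new variable, with slope `t v` bounded by `‖u j‖`, plus a remainder at
    -- most `a`.
    set V : Ω → (s → ℝ) := fun ω i => ε i ω with hV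
    set G : (s → ℝ) → H := fun v => ∑ i : s, v i • u i with hG
    have hGc : Continuous G := by fun_prop
    have hVm : Measurable V := measurable_pi_lambda _ fun i => hε i
    have hsum : ∀ ω, ∑ i ∈ s, ε i ω • u i = G (V ω) := fun ω => by
      rw [hG, hV]
      exact (Finset.sum_coe_sort s fun i => ε i ω • u i).symm
    set r : (s → ℝ) → ℝ := fun v => Real.sqrt (1 + ‖G v‖ ^ 2) with hr
    have hrc : Continuous r := by fun_prop
    have hrpos : ∀ v, 0 < r v := fun v => Real.sqrt_pos.2 (by positivity)
    set t : (s → ℝ) → ℝ := fun v => inner ℝ (G v) (u j) / r v with ht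
    have htc : Continuous t := Continuous.div (by fun_prop) hrc fun v => (hrpos v).ne'
    have htle : ∀ v, t v ^ 2 ≤ ‖u j‖ ^ 2 := fun v => by
      have hGr : ‖G v‖ ≤ r v := Real.le_sqrt_of_sq_le (by linarith)
      rw [← sq_abs (t v)]
      refine pow_le_pow_left₀ (abs_nonneg _) ?_ 2
      rw [ht]
      simp only
      rw [abs_div, abs_of_pos (hrpos v), div_le_iff₀ (hrpos v)]
      calc |inner ℝ (G v) (u j)| ≤ ‖G v‖ * ‖u j‖ := abs_real_inner_le_norm _ _
        _ ≤ r v * ‖u j‖ := by gcongr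
        _ = ‖u j‖ * r v := mul_comm _ _
    set a : ℝ := M ^ 2 * ‖u j‖ ^ 2 / 2 with ha
    set K : (s → ℝ) × ℝ → ENNReal := fun q =>
      ENNReal.ofReal (Real.exp (r q.1 + a)) * ENNReal.ofReal (Real.exp (t q.1 * q.2)) with hK
    have hKm : Measurable K := by
      have h1 : Continuous fun q : (s → ℝ) × ℝ => Real.exp (r q.1 + a) := by fun_prop
      have h2 : Continuous fun q : (s → ℝ) × ℝ => Real.exp (t q.1 * q.2) := by fun_prop
      exact h1.measurable.ennreal_ofReal.mul h2.measurable.ennreal_ofReal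
    have hindVj : IndepFun V (ε j) P := by
      have h := hind.indepFun_finset s {j} (by simpa using hj) hε
      exact h.comp (φ := id) (ψ := fun v : ({j} : Finset ι) → ℝ => v ⟨j, by simp⟩)
        measurable_id (measurable_pi_apply _)
    have hlaw := (indepFun_iff_map_prod_eq_prod_map_map hVm.aemeasurable
      (hε j).aemeasurable).1 hindVj
    have hprobj : IsProbabilityMeasure (P.map (ε j)) :=
      Measure.isProbabilityMeasure_map (hε j).aemeasurable
    have hprobV : IsProbabilityMeasure (P.map V) :=
      Measure.isProbabilityMeasure_map hVm.aemeasurable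
    calc ∫⁻ ω, ENNReal.ofReal
            (Real.exp (Real.sqrt (1 + ‖∑ i ∈ insert j s, ε i ω • u i‖ ^ 2))) ∂P
        ≤ ∫⁻ ω, K (V ω, ε j ω) ∂P := by
          refine lintegral_mono_ae ((hM j).mono fun ω hω => ?_)
          rw [hK]
          simp only
          rw [← ENNReal.ofReal_mul (Real.exp_pos _).le, ← Real.exp_add]
          refine ENNReal.ofReal_le_ofReal (Real.exp_le_exp.2 ?_)
          rw [Finset.sum_insert hj, add_comm (ε j ω • u j), hsum]
          refine (sqrt_one_add_norm_add_sq_le _ _).trans ?_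
          have h1 : inner ℝ (G (V ω)) (ε j ω • u j) / Real.sqrt (1 + ‖G (V ω)‖ ^ 2) =
              t (V ω) * ε j ω := by
            rw [real_inner_smul_right, ht, hr]
            ring
          have h2 : ‖ε j ω • u j‖ ^ 2 / 2 ≤ a := by
            rw [norm_smul, mul_pow, ha, Real.norm_eq_abs]
            have := pow_le_pow_left₀ (abs_nonneg _) hω 2
            gcongr
          rw [h1]
          change r (V ω) + _ + _ ≤ _
          linarith
      _ = ∫⁻ v, ∫⁻ e, K (v, e) ∂(P.map (ε j)) ∂(P.map V) := by
          rw [← lintegral_map hKm (hVm.prodMk (hε j)), hlaw,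
            lintegral_prod _ hKm.aemeasurable]
      -- Hoeffding's lemma at slope `t v` costs another `a`, so each new variable contributes `2a =
      -- M² ‖u j‖²` to the exponent.
      _ ≤ ∫⁻ v, ENNReal.ofReal (Real.exp (r v)) * ENNReal.ofReal (Real.exp (2 * a))
            ∂(P.map V) := by
          refine lintegral_mono fun v => ?_
          simp only [hK]
          rw [lintegral_const_mul _ (by fun_prop), lintegral_map (by fun_prop) (hε j)]
          refine (mul_le_mul_right (lintegral_exp_mul_le (hε j) (hM j) (h0 j) (t v)) _).trans ?_
          rw [← ENNReal.ofReal_mul (Real.exp_pos _).le, ← ENNReal.ofReal_mul (Real.exp_pos _).le,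
            ← Real.exp_add, ← Real.exp_add]
          refine ENNReal.ofReal_le_ofReal (Real.exp_le_exp.2 ?_)
          have := mul_le_mul_of_nonneg_left (htle v) (sq_nonneg M)
          rw [ha]
          linarith
      _ = (∫⁻ ω, ENNReal.ofReal (Real.exp (Real.sqrt (1 + ‖∑ i ∈ s, ε i ω • u i‖ ^ 2))) ∂P) *
            ENNReal.ofReal (Real.exp (2 * a)) := by
          rw [lintegral_mul_const _ (hrc.rexp.measurable.ennreal_ofReal),
            lintegral_map hrc.rexp.measurable.ennreal_ofReal hVm]
          simp only [hsum, hr]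
      _ ≤ ENNReal.ofReal (Real.exp (1 + M ^ 2 * ∑ i ∈ s, ‖u i‖ ^ 2)) *
            ENNReal.ofReal (Real.exp (2 * a)) := by gcongr
      _ = _ := by
          rw [← ENNReal.ofReal_mul (Real.exp_pos _).le, ← Real.exp_add, Finset.sum_insert hj, ha]
          congr 2
          ring

/-- Tail bound for the norm of a sum of independent bounded centred vectors. -/
theorem le_prob_norm_sum_le [Fintype ι] (hε : ∀ i, Measurable (ε i)) (hind : iIndepFun ε P)
    (h0 : ∀ i, ∫ ω, ε i ω ∂P = 0) {M : ℝ} (hM : ∀ i, ∀ᵐ ω ∂P, |ε i ω| ≤ M) (u : ι → H)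
    {B : ℝ} (hB : 0 < B) (hu : M ^ 2 * ∑ i, ‖u i‖ ^ 2 ≤ B ^ 2) {δ : ℝ} (hδ : 0 < δ) :
    ENNReal.ofReal (1 - δ) ≤ P {ω | ‖∑ i, ε i ω • u i‖ ≤ B * (2 + Real.log (1 / δ))} := by
  set f : Ω → ENNReal := fun ω => ENNReal.ofReal
    (Real.exp (Real.sqrt (1 + ‖∑ i, ε i ω • (B⁻¹ • u i)‖ ^ 2))) with hf
  have hcont : Continuous fun v : ι → ℝ =>
      Real.exp (Real.sqrt (1 + ‖∑ i, v i • (B⁻¹ • u i)‖ ^ 2)) := by fun_prop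
  have hfm : Measurable f :=
    (hcont.measurable.comp (measurable_pi_lambda _ hε)).ennreal_ofReal
  -- The threshold is `e²/δ`. After scaling by `B⁻¹` the exponential moment is at most `e^(1+1)`, so
  -- Markov's inequality leaves exactly `δ`.
  set T : ENNReal := ENNReal.ofReal (Real.exp (2 + Real.log (1 / δ))) with hT
  have hint : ∫⁻ ω, f ω ∂P ≤ ENNReal.ofReal (Real.exp 2) := by
    refine (lintegral_exp_sqrt_le hε hind h0 hM (fun i => B⁻¹ • u i) Finset.univ).trans
      (ENNReal.ofReal_le_ofReal (Real.exp_le_exp.2 ?_))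
    have h1 : M ^ 2 * ∑ i, ‖B⁻¹ • u i‖ ^ 2 = (M ^ 2 * ∑ i, ‖u i‖ ^ 2) / B ^ 2 := by
      simp only [norm_smul, mul_pow, ← Finset.mul_sum, norm_inv, Real.norm_eq_abs, sq_abs, inv_pow]
      field_simp
    rw [h1]
    have := (div_le_one (by positivity : 0 < B ^ 2)).2 hu
    linarith
  have hmarkov : P {ω | T ≤ f ω} ≤ ENNReal.ofReal δ := by
    refine (meas_ge_le_lintegral_div hfm.aemeasurable ?_ ENNReal.ofReal_ne_top).trans ?_
    · exact (ENNReal.ofReal_pos.2 (Real.exp_pos _)).ne'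
    · refine (ENNReal.div_le_div_right hint _).trans ?_
      rw [← ENNReal.ofReal_div_of_pos (Real.exp_pos _), Real.exp_add,
        Real.exp_log (by positivity)]
      refine ENNReal.ofReal_le_ofReal (le_of_eq ?_)
      have := (Real.exp_pos 2).ne'
      field_simp
  have hset : {ω | T ≤ f ω}ᶜ ⊆ {ω | ‖∑ i, ε i ω • u i‖ ≤ B * (2 + Real.log (1 / δ))} := by
    intro ω hω
    simp only [Set.mem_compl_iff, Set.mem_ofPred_eq, not_le] at hω ⊢
    have h1 := Real.exp_lt_exp.1 (ENNReal.ofReal_lt_ofReal_iff_of_nonneg (Real.exp_pos _).le |>.1 hω)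
    have h2 : ∑ i, ε i ω • (B⁻¹ • u i) = B⁻¹ • ∑ i, ε i ω • u i := by
      rw [Finset.smul_sum]
      exact Finset.sum_congr rfl fun i _ => smul_comm _ _ _
    have h3 : ‖∑ i, ε i ω • (B⁻¹ • u i)‖ ≤
        Real.sqrt (1 + ‖∑ i, ε i ω • (B⁻¹ • u i)‖ ^ 2) :=
      Real.le_sqrt_of_sq_le (by linarith)
    have h4 := h3.trans h1.le
    rw [h2, norm_smul, norm_inv, Real.norm_eq_abs, abs_of_pos hB, inv_mul_le_iff₀ hB] at h4
    exact h4
  refine le_trans ?_ (measure_mono hset)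
  rw [prob_compl_eq_one_sub (measurableSet_le measurable_const hfm),
    ENNReal.ofReal_sub _ hδ.le, ENNReal.ofReal_one]
  exact tsub_le_tsub_left hmarkov 1

end Concentration

end SphericalWRLS

end

/-! ### Bound on the effective dimension -/

noncomputable section

namespace SphericalWRLS

variable {d : ℕ}

theorem sum_rpow_tail_le {p : ℝ} (hp : 1 < p) {K : ℕ} (hK : 1 ≤ K) (n : ℕ) :
    ∑ i ∈ Finset.range n, ((K : ℝ) + (i + 1 : ℕ)) ^ (-p) ≤ (K : ℝ) ^ (1 - p) / (p - 1) := by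
  have hK' : (1 : ℝ) ≤ K := by exact_mod_cast hK
  have hanti : AntitoneOn (fun x : ℝ => x ^ (-p)) (Set.Icc (K : ℝ) (K + n)) := by
    intro x hx y _ hxy
    exact Real.rpow_le_rpow_of_nonpos (by linarith [hx.1]) hxy (by linarith)
  refine hanti.sum_le_integral.trans ?_
  have h0 : (0 : ℝ) ∉ Set.uIcc (K : ℝ) (K + n) := by
    rw [Set.uIcc_of_le (by linarith [(Nat.cast_nonneg n : (0 : ℝ) ≤ n)])]
    intro h
    linarith [h.1]
  rw [integral_rpow (Or.inr ⟨by linarith, h0⟩)]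
  have hp1 : 0 < p - 1 := by linarith
  have e : -p + 1 = -(p - 1) := by ring
  have e' : 1 - p = -(p - 1) := by ring
  rw [e, e', div_neg, ← neg_div]
  refine div_le_div_of_nonneg_right ?_ hp1.le
  have : 0 ≤ ((K : ℝ) + n) ^ (-(p - 1)) := by positivity
  linarith

/-- The minimum switches near `k = T`. Below, `∑ k^(d-1)` is of order `T^d`; above, the tail `T^(2γ)
∑ k^(d-1-2γ)` is of the same order, since `2γ > d`. -/
theorem exists_sum_min_le (d : ℕ) (hd : 1 ≤ d) {γ : ℝ} (hγ : (d : ℝ) / 2 < γ) :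
    ∃ C : ℝ, 0 < C ∧ ∀ T : ℝ, 0 < T → ∀ n : ℕ,
      ∑ k ∈ Finset.range n, max (k : ℝ) 1 ^ (d - 1) *
        min 1 (T ^ (2 * γ) * max (k : ℝ) 1 ^ (-(2 * γ))) ≤ C * T ^ d := by
  have hgap : 0 < 2 * γ - d := by linarith
  have hd' : (1 : ℝ) ≤ d := by exact_mod_cast hd
  refine ⟨2 * 2 ^ d + 1 / (2 * γ - d), by positivity, fun T hT n => ?_⟩
  set h : ℕ → ℝ := fun k => max (k : ℝ) 1 ^ (d - 1) *
    min 1 (T ^ (2 * γ) * max (k : ℝ) 1 ^ (-(2 * γ))) with hh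
  have hm : ∀ k : ℕ, (1 : ℝ) ≤ max (k : ℝ) 1 := fun k => le_max_right _ _
  have hnn : ∀ k, 0 ≤ h k := fun k => by
    have := hm k
    have : 0 < max (k : ℝ) 1 := by linarith
    rw [hh]
    positivity
  set K : ℕ := max 1 ⌈T⌉₊ with hKdef
  have hK1 : 1 ≤ K := le_max_left _ _
  have hTK : T ≤ K := (Nat.le_ceil T).trans (by exact_mod_cast le_max_right _ _)
  have hK1' : (1 : ℝ) ≤ K := by exact_mod_cast hK1
  have hsplit : ∑ k ∈ Finset.range n, h k ≤
      ∑ k ∈ Finset.range (K + 1), h k + ∑ i ∈ Finset.range n, h (K + 1 + i) := by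
    rw [← Finset.sum_range_add]
    exact Finset.sum_le_sum_of_subset_of_nonneg
      (Finset.range_subset_range.2 (by omega)) fun _ _ _ => hnn _
  have hhead : ∑ k ∈ Finset.range (K + 1), h k ≤ 2 * 2 ^ d * T ^ d := by
    rcases le_or_gt 1 T with hT1 | hT1
    · have hK2 : (K : ℝ) ≤ 2 * T := by
        rw [hKdef]
        push_cast
        exact max_le (by linarith) (by linarith [(Nat.ceil_lt_add_one hT.le).le])
      have hle : ∀ k ∈ Finset.range (K + 1), h k ≤ (K : ℝ) ^ (d - 1) := fun k hk => by
        have hkK : (k : ℝ) ≤ K := by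
          exact_mod_cast Nat.lt_succ_iff.1 (Finset.mem_range.1 hk)
        have h1 : max (k : ℝ) 1 ^ (d - 1) ≤ (K : ℝ) ^ (d - 1) :=
          pow_le_pow_left₀ (by linarith [hm k]) (max_le hkK hK1') _
        calc h k ≤ max (k : ℝ) 1 ^ (d - 1) * 1 :=
              mul_le_mul_of_nonneg_left (min_le_left _ _) (pow_nonneg (by linarith [hm k]) _)
          _ ≤ _ := by linarith
      calc ∑ k ∈ Finset.range (K + 1), h k ≤ (K + 1 : ℕ) • (K : ℝ) ^ (d - 1) := by
            simpa using Finset.sum_le_card_nsmul _ _ _ hle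
        _ ≤ 2 * (K : ℝ) ^ d := by
            obtain ⟨e, rfl⟩ : ∃ e, d = e + 1 := ⟨d - 1, by omega⟩
            rw [nsmul_eq_mul, Nat.add_sub_cancel, pow_succ]
            push_cast
            have : (0 : ℝ) ≤ (K : ℝ) ^ e := by positivity
            nlinarith
        _ ≤ 2 * (2 * T) ^ d := by gcongr
        _ = 2 * 2 ^ d * T ^ d := by rw [mul_pow]; ring
    -- For `T < 1` the head consists of `k = 0, 1` only, and `T^(2γ) ≤ T^d` keeps the bound valid.
    -- This is the range of large `λ`.
    · have hKeq : K = 1 := by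
        rw [hKdef]
        exact max_eq_left (Nat.ceil_le.2 (by simpa using hT1.le))
      have hTd : T ^ (2 * γ) ≤ T ^ d := by
        rw [← Real.rpow_natCast]
        exact Real.rpow_le_rpow_of_exponent_ge hT hT1.le (by linarith)
      have hpow : (1 : ℝ) ≤ 2 ^ d := one_le_pow₀ (by norm_num)
      have hTd0 : 0 < T ^ d := by positivity
      rw [hKeq, Finset.sum_range_succ, Finset.sum_range_one]
      have h0 : h 0 ≤ T ^ d := by simpa [hh] using Or.inr hTd
      have h1 : h 1 ≤ T ^ d := by simpa [hh] using Or.inr hTd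
      nlinarith
  have htail : ∑ i ∈ Finset.range n, h (K + 1 + i) ≤ 1 / (2 * γ - d) * T ^ d := by
    have hle : ∀ i ∈ Finset.range n, h (K + 1 + i) ≤
        T ^ (2 * γ) * ((K : ℝ) + (i + 1 : ℕ)) ^ (-(2 * γ - d + 1)) := fun i _ => by
      have hmk : max ((K + 1 + i : ℕ) : ℝ) 1 = (K : ℝ) + (i + 1 : ℕ) := by
        rw [max_eq_left]
        · push_cast; ring
        · exact_mod_cast (by omega : 1 ≤ K + 1 + i)
      have hpos : (0 : ℝ) < (K : ℝ) + (i + 1 : ℕ) := by positivity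
      simp only [hh]
      rw [hmk]
      calc ((K : ℝ) + (i + 1 : ℕ)) ^ (d - 1) *
            min 1 (T ^ (2 * γ) * ((K : ℝ) + (i + 1 : ℕ)) ^ (-(2 * γ)))
          ≤ ((K : ℝ) + (i + 1 : ℕ)) ^ (d - 1) *
            (T ^ (2 * γ) * ((K : ℝ) + (i + 1 : ℕ)) ^ (-(2 * γ))) := by
            gcongr
            exact min_le_right _ _
        _ = T ^ (2 * γ) * ((K : ℝ) + (i + 1 : ℕ)) ^ (-(2 * γ - d + 1)) := by
            rw [← Real.rpow_natCast ((K : ℝ) + (i + 1 : ℕ)) (d - 1), mul_left_comm,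
              ← Real.rpow_add hpos, Nat.cast_sub hd]
            congr 2
            push_cast
            ring
    refine (Finset.sum_le_sum hle).trans ?_
    rw [← Finset.mul_sum]
    have h1 := sum_rpow_tail_le (p := 2 * γ - d + 1) (by linarith) hK1 n
    have h2 : (K : ℝ) ^ (1 - (2 * γ - d + 1)) ≤ T ^ (1 - (2 * γ - d + 1)) :=
      Real.rpow_le_rpow_of_nonpos hT hTK (by linarith)
    calc T ^ (2 * γ) * ∑ i ∈ Finset.range n, ((K : ℝ) + (i + 1 : ℕ)) ^ (-(2 * γ - d + 1))
        ≤ T ^ (2 * γ) * (T ^ (1 - (2 * γ - d + 1)) / (2 * γ - d + 1 - 1)) := by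
          refine mul_le_mul_of_nonneg_left (h1.trans ?_) (by positivity)
          exact div_le_div_of_nonneg_right h2 (by linarith)
      _ = 1 / (2 * γ - d) * T ^ d := by
          rw [mul_div_assoc', ← Real.rpow_add hT, ← Real.rpow_natCast T d,
            show 2 * γ + (1 - (2 * γ - d + 1)) = (d : ℝ) by ring,
            show 2 * γ - (d : ℝ) + 1 - 1 = 2 * γ - d by ring]
          ring
  calc ∑ k ∈ Finset.range n, h k ≤ _ := hsplit
    _ ≤ 2 * 2 ^ d * T ^ d + 1 / (2 * γ - d) * T ^ d := add_le_add hhead htail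
    _ = _ := by ring

/-- The effective dimension is at most a multiple of `(b / λ)^(d / 2γ)`. -/
theorem exists_effectiveDimension_le (d : ℕ) (hd : 1 ≤ d) {γ : ℝ} (hγ : (d : ℝ) / 2 < γ) :
    ∃ C : ℝ, 0 < C ∧ ∀ (b lam : ℝ), 0 < b → 0 < lam → ∀ a : ℕ → ℝ, (∀ k, 0 < a k) →
      (∀ k : ℕ, a k ≤ b * max (k : ℝ) 1 ^ (-(2 * γ))) →
      ∑' k, a k / (a k + lam) * (harmDim d k / sphVol d) ≤ C * (b / lam) ^ ((d : ℝ) / (2 * γ)) := by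
  obtain ⟨C, hC, hsum⟩ := exists_sum_min_le d hd hγ
  have hd' : (1 : ℝ) ≤ d := by exact_mod_cast hd
  have hγ0 : 0 < γ := by linarith
  have hΩ := sphVol_pos d
  refine ⟨2 ^ d / sphVol d * C, by positivity, fun b lam hb hlam a ha hab => ?_⟩
  -- The crossover degree: `T^(2γ) = b/λ` is where the eigenvalue bound meets `λ`.
  set T : ℝ := (b / lam) ^ (1 / (2 * γ)) with hTdef
  have hbl : 0 < b / lam := by positivity
  have hT : 0 < T := by positivity
  have hT2 : T ^ (2 * γ) = b / lam := by
    rw [hTdef, ← Real.rpow_mul hbl.le, one_div_mul_cancel (by positivity), Real.rpow_one]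
  have hTd : T ^ d = (b / lam) ^ ((d : ℝ) / (2 * γ)) := by
    rw [hTdef, ← Real.rpow_natCast, ← Real.rpow_mul hbl.le]
    congr 1
    ring
  have hterm : ∀ k : ℕ, a k / (a k + lam) * (harmDim d k / sphVol d) ≤
      2 ^ d / sphVol d * (max (k : ℝ) 1 ^ (d - 1) *
        min 1 (T ^ (2 * γ) * max (k : ℝ) 1 ^ (-(2 * γ)))) := fun k => by
    have hak := ha k
    have hm : (1 : ℝ) ≤ max (k : ℝ) 1 := le_max_right _ _
    have hdim : (harmDim d k : ℝ) ≤ 2 ^ d * max (k : ℝ) 1 ^ (d - 1) := by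
      calc (harmDim d k : ℝ) ≤ 2 * ((k : ℝ) + 1) ^ (d - 1) := by exact_mod_cast harmDim_le hd k
        _ ≤ 2 * (2 * max (k : ℝ) 1) ^ (d - 1) := by
            gcongr
            linarith [le_max_left (k : ℝ) 1]
        _ = 2 ^ d * max (k : ℝ) 1 ^ (d - 1) := by
            obtain ⟨e, rfl⟩ : ∃ e, d = e + 1 := ⟨d - 1, by omega⟩
            rw [Nat.add_sub_cancel, mul_pow, pow_succ]
            ring
    have hmin : a k / (a k + lam) ≤ min 1 (T ^ (2 * γ) * max (k : ℝ) 1 ^ (-(2 * γ))) := by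
      refine le_min ((div_le_one (by linarith)).2 (by linarith)) ?_
      rw [hT2]
      calc a k / (a k + lam) ≤ a k / lam := by
            gcongr
            linarith
        _ ≤ b * max (k : ℝ) 1 ^ (-(2 * γ)) / lam := by
            gcongr
            exact hab k
        _ = _ := by ring
    calc a k / (a k + lam) * (harmDim d k / sphVol d)
        ≤ min 1 (T ^ (2 * γ) * max (k : ℝ) 1 ^ (-(2 * γ))) *
          (2 ^ d * max (k : ℝ) 1 ^ (d - 1) / sphVol d) := by
          gcongr
      _ = _ := by ring
  refine Real.tsum_le_of_sum_range_le (fun k => ?_) fun n => ?_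
  · have := ha k
    positivity
  · refine (Finset.sum_le_sum fun k _ => hterm k).trans ?_
    rw [← Finset.mul_sum, ← hTd, mul_assoc]
    exact mul_le_mul_of_nonneg_left (hsum T hT n) (by positivity)

end SphericalWRLS

end

/-! ### Reduction to the noise and the final estimate -/

noncomputable section

namespace SphericalWRLS

variable {d : ℕ}

theorem empOp_sub_samplingT {φ : ℝ → ℝ} {N : ℕ} (w : Fin N → ℝ) (x : Fin N → Sph d)
    (f : Sph d → ℝ) (e y : Fin N → ℝ) (hy : ∀ i, y i = f (x i) + e i) :
    empOp φ w x f - samplingT φ w x y = ∑ i, (-(w i * e i)) • kernelAt d φ (x i) := by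
  rw [empOp, samplingT, samplingT, ← Finset.sum_sub_distrib]
  refine Finset.sum_congr rfl fun i _ => ?_
  rw [← sub_smul, hy, sampling]
  congr 1
  ring

theorem summable_effectiveDimension {φ : ℝ → ℝ} (hφ : IsPosDefSBF d φ) {lam : ℝ}
    (hlam : 0 < lam) :
    Summable fun k => coeff d φ k / (coeff d φ k + lam) * (harmDim d k / sphVol d) := by
  have hΩ := sphVol_pos d
  refine Summable.of_nonneg_of_le (fun k => ?_) (fun k => ?_) (hφ.summable.mul_left lam⁻¹)
  · have := hφ.coeff_pos k
    positivity
  · have := hφ.coeff_pos k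
    calc coeff d φ k / (coeff d φ k + lam) * (harmDim d k / sphVol d)
        ≤ coeff d φ k / lam * (harmDim d k / sphVol d) := by
          gcongr
          linarith
      _ = _ := by ring

/-- Since `3 > e`, the additive 2 is absorbed by `2 log 3`. This is where the 3 in `log (3/δ)` comes
from. -/
theorem two_add_log_le {δ : ℝ} (hδ : 0 < δ) (hδ1 : δ < 1) :
    2 + Real.log (1 / δ) ≤ 2 * Real.log (3 / δ) := by
  have h3 : 1 ≤ Real.log 3 := by
    rw [Real.le_log_iff_exp_le (by norm_num)]
    linarith [Real.exp_one_lt_d9]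
  have h1 : 0 ≤ Real.log (1 / δ) := Real.log_nonneg ((one_le_div hδ).2 hδ1.le)
  have h : Real.log (3 / δ) = Real.log 3 + Real.log (1 / δ) := by
    rw [← Real.log_mul (by norm_num) (by positivity)]
    congr 1
    ring
  linarith

end SphericalWRLS
end

open SphericalWRLS in
theorem proposition6 (d : ℕ) (hd : 1 ≤ d) (γ : ℝ) (hγ : (d : ℝ) / 2 < γ) (b c₁ : ℝ) :
    ∃ C : ℝ, 0 < C ∧
      ∀ (Y : (k : ℕ) → Fin (harmDim d k) → Sph d → ℝ), IsHarmONB d Y →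
      ∀ (φ : ℝ → ℝ), IsPosDefSBF d φ →
      ∀ a : ℝ, 0 < a →
      (∀ k : ℕ, a * max (k : ℝ) 1 ^ (-(2 * γ)) ≤ coeff d φ k ∧
        coeff d φ k ≤ b * max (k : ℝ) 1 ^ (-(2 * γ))) →
      ∀ (s N : ℕ) (w : Fin N → ℝ) (x : Fin N → Sph d), IsQuadRule d s w x →
      (∀ i, w i ≤ c₁ * (N : ℝ)⁻¹) →
      ∀ (fstar : Sph d → ℝ) (lam M δ : ℝ), 0 < lam → 0 < M → 0 < δ → δ < 1 →
      ∀ (Ω : Type*) [MeasurableSpace Ω] (P : Measure Ω) [IsProbabilityMeasure P]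
        (ε y : Fin N → Ω → ℝ),
      (∀ i, Measurable (ε i)) → iIndepFun ε P → (∀ i, ∫ ω, ε i ω ∂P = 0) →
      (∀ i, ∀ᵐ ω ∂P, |ε i ω| ≤ M) →
      (∀ i ω, y i ω = fstar (x i) + ε i ω) →
      (∀ ω,
        MemNative Y φ (empOp φ w x fstar - samplingT φ w x fun i => y i ω) ∧
        MemNative Y φ
          (invSqrt Y φ lam (empOp φ w x fstar - samplingT φ w x fun i => y i ω))) ∧
      ENNReal.ofReal (1 - δ) ≤
        P {ω | nativeNorm Y φ
            (invSqrt Y φ lam (empOp φ w x fstar - samplingT φ w x fun i => y i ω))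
          ≤ C * M * lam ^ (-((d : ℝ) / (4 * γ))) * (N : ℝ) ^ (-(1 / 2) : ℝ)
              * Real.log (3 / δ)} := by
  obtain ⟨C₀, hC₀, heff⟩ := exists_effectiveDimension_le d hd hγ
  have hd' : (1 : ℝ) ≤ d := by exact_mod_cast hd
  have hγ0 : 0 < γ := by linarith
  -- The constant is chosen before any data, when nothing forces `b` or `c₁` to be positive;
  -- enlarging them makes it positive.
  set b' : ℝ := |b| + 1 with hb'
  set c' : ℝ := |c₁| + 1 with hc'
  have hb'0 : 0 < b' := by positivity
  have hc'0 : 0 < c' := by positivity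
  refine ⟨2 * (c' * Real.sqrt (C₀ * b' ^ ((d : ℝ) / (2 * γ)))), by positivity, ?_⟩
  intro Y hY φ hφ a _ hcoeff s N w x hw hwle fstar lam M δ hlam hM hδ hδ1 Ω _ P _ ε y
    hε hind h0 hεM hy
  have hsub : ∀ ω, (empOp φ w x fstar - samplingT φ w x fun i => y i ω) =
      ∑ i, (-(w i * ε i ω)) • kernelAt d φ (x i) :=
    fun ω => empOp_sub_samplingT w x fstar (fun i => ε i ω) _ fun i => hy i ω
  simp only [hsub]
  refine ⟨fun ω => ⟨(hY.memNative_sum_kernelAt hd hφ x _).2,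
    (hY.memNative_invSqrt hd hφ x _ hlam).2⟩, ?_⟩
  have hρ : ∀ k, 0 ≤ coeff d φ k / (coeff d φ k + lam) := fun k => by
    have := hφ.coeff_pos k
    positivity
  have hsum := summable_effectiveDimension hφ hlam
  set u := fun i => (-w i) • hY.feature hd hρ hsum (x i) with hu
  have hnorm : ∀ ω, nativeNorm Y φ
      (invSqrt Y φ lam (∑ i, (-(w i * ε i ω)) • kernelAt d φ (x i))) =
        ‖∑ i, ε i ω • u i‖ := fun ω => by
    rw [hY.nativeNorm_invSqrt hd hφ hlam x _ hρ hsum]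
    congr 1
    refine Finset.sum_congr rfl fun i _ => ?_
    rw [hu, smul_smul]
    congr 1
    ring
  simp only [hnorm]
  have hlog : 0 ≤ Real.log (3 / δ) := Real.log_nonneg (by rw [le_div_iff₀ hδ]; linarith)
  -- The tail bound needs a positive scale, but `0 ^ (-1/2) = 0` makes the scale vanish when `N =
  -- 0`. There the sum is empty.
  rcases Nat.eq_zero_or_pos N with rfl | hN
  · have huniv : {ω : Ω | ‖∑ i, ε i ω • u i‖ ≤
        2 * (c' * Real.sqrt (C₀ * b' ^ ((d : ℝ) / (2 * γ)))) * M *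
          lam ^ (-((d : ℝ) / (4 * γ))) * ((0 : ℕ) : ℝ) ^ (-(1 / 2) : ℝ) * Real.log (3 / δ)} =
        Set.univ := by
      refine Set.eq_univ_of_forall fun ω => ?_
      rw [Set.mem_ofPred_eq, Finset.univ_eq_empty, Finset.sum_empty, norm_zero]
      positivity
    rw [huniv, measure_univ]
    exact ENNReal.ofReal_le_one.2 (by linarith)
  have hN' : (0 : ℝ) < N := by exact_mod_cast hN
  set B : ℝ := c' * Real.sqrt (C₀ * b' ^ ((d : ℝ) / (2 * γ))) * M *
    lam ^ (-((d : ℝ) / (4 * γ))) * (N : ℝ) ^ (-(1 / 2) : ℝ) with hB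
  have hBpos : 0 < B := by positivity
  have hB2 : B ^ 2 = M ^ 2 * (c' ^ 2 * (C₀ * (b' / lam) ^ ((d : ℝ) / (2 * γ))) / N) := by
    have h1 : (lam ^ (-((d : ℝ) / (4 * γ)))) ^ 2 = (lam ^ ((d : ℝ) / (2 * γ)))⁻¹ := by
      rw [← Real.rpow_natCast, ← Real.rpow_mul hlam.le, ← Real.rpow_neg hlam.le]
      congr 1
      push_cast
      field_simp
      norm_num
    have h2 : ((N : ℝ) ^ (-(1 / 2) : ℝ)) ^ 2 = (N : ℝ)⁻¹ := by
      rw [← Real.rpow_natCast, ← Real.rpow_mul hN'.le, ← Real.rpow_neg_one]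
      norm_num
    rw [hB, mul_pow, mul_pow, mul_pow, mul_pow, h1, h2, Real.sq_sqrt (by positivity),
      Real.div_rpow hb'0.le hlam.le]
    field_simp
  have huB : M ^ 2 * ∑ i, ‖u i‖ ^ 2 ≤ B ^ 2 := by
    rw [hB2]
    refine mul_le_mul_of_nonneg_left ?_ (sq_nonneg M)
    have hcoeff' : ∀ k : ℕ, coeff d φ k ≤ b' * max (k : ℝ) 1 ^ (-(2 * γ)) := fun k => by
      refine (hcoeff k).2.trans (mul_le_mul_of_nonneg_right ?_ (by positivity))
      linarith [le_abs_self b]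
    have heff' := heff b' lam hb'0 hlam _ hφ.coeff_pos hcoeff'
    -- Each term is `w_i²` times the effective dimension. Summing `N` copies of `(c'/N)²` leaves the
    -- factor `1/N`.
    have hui : ∀ i ∈ Finset.univ, ‖u i‖ ^ 2 ≤
        (c' * (N : ℝ)⁻¹) ^ 2 * (C₀ * (b' / lam) ^ ((d : ℝ) / (2 * γ))) := fun i _ => by
      rw [hu]
      simp only
      rw [norm_smul, mul_pow, hY.norm_feature_sq, norm_neg, Real.norm_eq_abs, sq_abs]
      have hwi : w i ≤ c' * (N : ℝ)⁻¹ := by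
        refine (hwle i).trans (mul_le_mul_of_nonneg_right ?_ (by positivity))
        linarith [le_abs_self c₁]
      have hwi0 := hw.nonneg i
      have hdim0 : 0 ≤ ∑' k, coeff d φ k / (coeff d φ k + lam) * (harmDim d k / sphVol d) :=
        tsum_nonneg fun k => mul_nonneg (hρ k) (by have := sphVol_pos d; positivity)
      gcongr
    refine (Finset.sum_le_card_nsmul _ _ _ hui).trans_eq ?_
    rw [Finset.card_univ, Fintype.card_fin, nsmul_eq_mul]
    field_simp
  refine (le_prob_norm_sum_le hε hind h0 hεM u hBpos huB hδ).trans (measure_mono fun ω hω => ?_)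
  rw [Set.mem_ofPred_eq] at hω ⊢
  calc ‖∑ i, ε i ω • u i‖ ≤ B * (2 + Real.log (1 / δ)) := hω
    _ ≤ B * (2 * Real.log (3 / δ)) := mul_le_mul_of_nonneg_left (two_add_log_le hδ hδ1) hBpos.le
    _ = _ := by rw [hB]; ring
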